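/- Let $1<\alpha<\beta<\infty$, $\Omega=(-\infty,0)\cup(1,\alpha)\cup(\beta,\infty)$, and $e(x)=e^{2\pi i x}$. Let $w,\theta,\phi,\psi\in\mathbb R$ with $0<w<1$, and let $$B=\begin{pmatrix} w\,e(\phi) & -\sqrt{1-w^2}\,e(\theta-\psi)\\ \sqrt{1-w^2}\,e(\psi) & w\,e(\theta-\phi)\end{pmatrix}\in U(2).$$ Let $P_B$ be the operator in $L^2(\Omega)$ given by $P_Bf=\frac1{2\pi i}f'$, whose domain $\mathcal D(P_B)$ consists of all $f\in L^2(\Omega)$ that have a representative which is locally absolutely continuous on $\overline\Omega=(-\infty,0]\cup[1,\alpha]\cup[\beta,\infty)$, with $f'\in L^2(\Omega)$ and $B\,(f(1),f(\beta))^{T}=(f(0),f(\alpha))^{T}$. For $\lambda\in\mathbb R$ put $$a(\lambda)=w^{-1}e(\phi)e(\lambda)\bigl(1-\sqrt{1-w^2}\,e(-\psi+(\alpha-1)\lambda)\bigr),$$ $$c(\lambda)=w^{-1}e(\phi-\theta)e(-(\beta-\alpha)\lambda)\bigl(1-\sqrt{1-w^2}\,e(\psi-(\alpha-1)\lambda)\bigr),$$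 $$\psi_\lambda(x)=\bigl(a(\lambda)\chi_{(-\infty,0)}(x)+\chi_{(1,\alpha)}(x)+c(\lambda)\chi_{(\beta,\infty)}(x)\bigr)e(\lambda x),$$ $$m_B(\lambda)=|a(\lambda)|,\qquad \sigma_B(d\lambda)=m_B(\lambda)^{-2}\,d\lambda .$$ Then there is a unitary operator $V_B$ from $L^2(\Omega)$ onto $L^2(\mathbb R,\sigma_B)$ such that, for every $f\in L^2(\Omega)$, $$(V_Bf)(\lambda)=\langle\psi_\lambda,f\rangle=\int_\Omega\overline{\psi_\lambda(x)}\,f(x)\,dx ,$$ where the integral is the limit in $L^2(\sigma_B)$, as $R\to\infty$, of the integrals over $\Omega\cap[-R,R]$; for $f\in L^1(\Omega)\cap L^2(\Omega)$ the formula also holds with an absolutely convergent integral, for almost every $\lambda$. Moreover, for every $f\in L^2(\Omega)$, $$f(x)=\int_{\mathbb R}\langle\psi_\lambda,f\rangle\,\psi_\lambda(x)\,\sigma_B(d\lambda),\qquad \int_\Omega|f(x)|^2\,dx=\int_{\mathbb R}|\langle\psi_\lambda,f\rangle|^2\,\sigma_B(d\lambda),$$ and for every $f\in\mathcal D(P_B)$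 one has $\langle\psi_\lambda,P_Bf\rangle=\lambda\langle\psi_\lambda,f\rangle$ for almost every $\lambda$ and $$P_Bf(x)=\int_{\mathbb R}\langle\psi_\lambda,P_Bf\rangle\,\psi_\lambda(x)\,\sigma_B(d\lambda)=\int_{\mathbb R}\lambda\,\langle\psi_\lambda,f\rangle\,\psi_\lambda(x)\,\sigma_B(d\lambda).$$ Here $\langle\psi_\lambda,g\rangle$ denotes $(V_Bg)(\lambda)$, and the vector-valued integrals over $\lambda\in\mathbb R$ are the limits in $L^2(\Omega)$, as $R\to\infty$, of the integrals over $[-R,R]$. -/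

import Mathlib

open MeasureTheory Filter Set
open scoped Topology ENNReal Matrix ComplexConjugate

noncomputable section

namespace TwoIntervals

/-- The exterior domain `Ω = (-∞, 0) ∪ (1, α) ∪ (β, ∞)`. -/
def Omega (α β : ℝ) : Set ℝ := Iio 0 ∪ Ioo 1 α ∪ Ioi β

/-- The Hilbert space `L²(Ω)` of complex valued functions, with Lebesgue measure. -/
abbrev L2Omega (α β : ℝ) : Type := Lp ℂ 2 (volume.restrict (Omega α β))

/-- `e(x) = exp(2πix)`. -/
def e (x : ℝ) : ℂ := Complex.exp (2 * Real.pi * Complex.I * x)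

/-- The matrix `B(w, θ, φ, ψ)`. For `0 ≤ w ≤ 1` these matrices are exactly the elements of `U(2)`. -/
def paramMatrix (w θ φ ψ : ℝ) : Matrix (Fin 2) (Fin 2) ℂ :=
  !![(w : ℂ) * e φ, -(Real.sqrt (1 - w ^ 2) : ℂ) * e (θ - ψ);
     (Real.sqrt (1 - w ^ 2) : ℂ) * e ψ, (w : ℂ) * e (θ - φ)]

/-! ### The selfadjoint momentum operator `P_B` -/

/-- `F` is a representative of the class `f ∈ L²(Ω)` which is absolutely continuous up to the
boundary of `Ω` (on each compact interval contained in the closure of `Ω`), has a derivative in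
`L²(Ω)`, and satisfies the boundary condition `B (F(1), F(β)) = (F(0), F(α))`. Here
`F(1), F(β)` and `F(0), F(α)` are one-sided boundary values from inside `Ω`, as `F` is continuous
on each component of the closure of `Ω`. -/
structure IsRegularRep (α β : ℝ) (B : Matrix (Fin 2) (Fin 2) ℂ) (f : L2Omega α β) (F : ℝ → ℂ) :
    Prop where
  ae_eq : f =ᵐ[volume.restrict (Omega α β)] F
  absCont : ∀ a b : ℝ, uIcc a b ⊆ closure (Omega α β) → AbsolutelyContinuousOnInterval F a b
  memLp_deriv : MemLp (deriv F) 2 (volume.restrict (Omega α β))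
  boundary : B *ᵥ ![F 1, F β] = ![F 0, F α]

section aux

variable {α β : ℝ} {B : Matrix (Fin 2) (Fin 2) ℂ} {f g : L2Omega α β} {F G : ℝ → ℂ}

theorem isOpen_Omega (α β : ℝ) : IsOpen (Omega α β) :=
  (isOpen_Iio.union isOpen_Ioo).union isOpen_Ioi

theorem exists_rat_Icc {U : Set ℝ} (hU : IsOpen U) {x : ℝ} (hx : x ∈ U) :
    ∃ p q : ℚ, (p : ℝ) < x ∧ x < q ∧ uIcc (p : ℝ) q ⊆ U := by
  obtain ⟨r, hr, hb⟩ := Metric.isOpen_iff.1 hU x hx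
  obtain ⟨p, hp1, hp2⟩ := exists_rat_btwn (show x - r < x by linarith)
  obtain ⟨q, hq1, hq2⟩ := exists_rat_btwn (show x < x + r by linarith)
  refine ⟨p, q, hp2, hq1, fun y hy => hb ?_⟩
  rw [uIcc_of_le (by linarith)] at hy
  rw [Metric.mem_ball, Real.dist_eq, abs_lt]
  constructor <;> linarith [hy.1, hy.2]

theorem IsRegularRep.continuousOn (h : IsRegularRep α β B f F) :
    ContinuousOn F (Omega α β) := by
  intro x hx
  obtain ⟨p, q, hp, hq, hsub⟩ := exists_rat_Icc (isOpen_Omega α β) hx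
  have h1 := (h.absCont p q (hsub.trans subset_closure)).continuousOn
  rw [uIcc_of_le (by linarith)] at h1
  exact (h1.continuousAt (Icc_mem_nhds hp hq)).continuousWithinAt

theorem IsRegularRep.ae_differentiableAt (h : IsRegularRep α β B f F) :
    ∀ᵐ x ∂(volume.restrict (Omega α β)), DifferentiableAt ℝ F x := by
  rw [ae_restrict_iff' (isOpen_Omega α β).measurableSet]
  have key : ∀ᵐ x : ℝ, ∀ p q : ℚ, uIcc (p : ℝ) q ⊆ Omega α β →
      x ∈ uIcc (p : ℝ) q → DifferentiableAt ℝ F x := by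
    rw [ae_all_iff]; intro p
    rw [ae_all_iff]; intro q
    by_cases hs : uIcc (p : ℝ) q ⊆ Omega α β
    · filter_upwards [(h.absCont p q
        (hs.trans subset_closure)).boundedVariationOn.ae_differentiableAt_of_mem_uIcc]
        with x hx _ using hx
    · exact Eventually.of_forall fun x hx => absurd hx hs
  filter_upwards [key] with x hx hxO
  obtain ⟨p, q, hp, hq, hsub⟩ := exists_rat_Icc (isOpen_Omega α β) hxO
  refine hx p q hsub ?_
  rw [uIcc_of_le (by linarith)]
  exact ⟨hp.le, hq.le⟩

theorem IsRegularRep.deriv_ae_eq (h : IsRegularRep α β B f F) (h' : IsRegularRep α β B f G) :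
    deriv F =ᵐ[volume.restrict (Omega α β)] deriv G := by
  have hEq : EqOn F G (Omega α β) :=
    Measure.eqOn_open_of_ae_eq (h.ae_eq.symm.trans h'.ae_eq) (isOpen_Omega α β)
      h.continuousOn h'.continuousOn
  rw [EventuallyEq, ae_restrict_iff' (isOpen_Omega α β).measurableSet]
  exact Eventually.of_forall fun x hx =>
    (hEq.eventuallyEq_of_mem ((isOpen_Omega α β).mem_nhds hx)).deriv_eq

theorem IsRegularRep.deriv_add_ae_eq (h : IsRegularRep α β B f F)
    (h' : IsRegularRep α β B g G) :
    deriv (F + G) =ᵐ[volume.restrict (Omega α β)] deriv F + deriv G := by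
  filter_upwards [h.ae_differentiableAt, h'.ae_differentiableAt] with x hx hx'
  exact deriv_add hx hx'

theorem deriv_smul_eq (c : ℂ) (F : ℝ → ℂ) : deriv (c • F) = c • deriv F := by
  funext x
  exact deriv_const_mul_field c

theorem IsRegularRep.add (h : IsRegularRep α β B f F) (h' : IsRegularRep α β B g G) :
    IsRegularRep α β B (f + g) (F + G) where
  ae_eq := (Lp.coeFn_add f g).trans (h.ae_eq.add h'.ae_eq)
  absCont a b hab := (h.absCont a b hab).add (h'.absCont a b hab)
  memLp_deriv := (memLp_congr_ae (h.deriv_add_ae_eq h')).2 (h.memLp_deriv.add h'.memLp_deriv)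
  boundary := by
    have e1 : ![(F + G) 1, (F + G) β] = ![F 1, F β] + ![G 1, G β] := by simp
    have e2 : ![(F + G) 0, (F + G) α] = ![F 0, F α] + ![G 0, G α] := by simp
    rw [e1, e2, Matrix.mulVec_add, h.boundary, h'.boundary]

theorem IsRegularRep.smul (c : ℂ) (h : IsRegularRep α β B f F) :
    IsRegularRep α β B (c • f) (c • F) where
  ae_eq := (Lp.coeFn_smul c f).trans (h.ae_eq.const_smul c)
  absCont a b hab := (h.absCont a b hab).const_smul c
  memLp_deriv := by rw [deriv_smul_eq]; exact h.memLp_deriv.const_smul c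
  boundary := by
    have e1 : ![(c • F) 1, (c • F) β] = c • ![F 1, F β] := by simp
    have e2 : ![(c • F) 0, (c • F) α] = c • ![F 0, F α] := by simp
    rw [e1, e2, Matrix.mulVec_smul, h.boundary]

theorem IsRegularRep.zero : IsRegularRep α β B (0 : L2Omega α β) (0 : ℝ → ℂ) where
  ae_eq := Lp.coeFn_zero _ _ _
  absCont a b _ := by
    have h : LipschitzOnWith 0 (0 : ℝ → ℂ) (uIcc a b) := fun x _ y _ => by simp
    exact h.absolutelyContinuousOnInterval
  memLp_deriv := by
    have h : deriv (0 : ℝ → ℂ) = 0 := by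
      funext x
      exact deriv_const x (0 : ℂ)
    rw [h]; exact MemLp.zero
  boundary := by
    have e1 : ![(0 : ℝ → ℂ) 1, (0 : ℝ → ℂ) β] = 0 := by
      funext i; fin_cases i <;> rfl
    have e2 : ![(0 : ℝ → ℂ) 0, (0 : ℝ → ℂ) α] = 0 := by
      funext i; fin_cases i <;> rfl
    rw [e1, e2, Matrix.mulVec_zero]

end aux

/-- The domain `D(P_B)`. -/
def momentumDomain (α β : ℝ) (B : Matrix (Fin 2) (Fin 2) ℂ) : Submodule ℂ (L2Omega α β) where
  carrier := {f | ∃ F : ℝ → ℂ, IsRegularRep α β B f F}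
  add_mem' := fun ⟨F, hF⟩ ⟨G, hG⟩ => ⟨F + G, hF.add hG⟩
  zero_mem' := ⟨0, IsRegularRep.zero⟩
  smul_mem' := fun c _ ⟨F, hF⟩ => ⟨c • F, hF.smul c⟩

/-- A regular representative of `f ∈ D(P_B)`. -/
def regularRep {α β : ℝ} {B : Matrix (Fin 2) (Fin 2) ℂ} (f : momentumDomain α β B) : ℝ → ℂ :=
  Classical.choose (show ∃ F : ℝ → ℂ, IsRegularRep α β B f F from f.2)

theorem regularRep_spec {α β : ℝ} {B : Matrix (Fin 2) (Fin 2) ℂ} (f : momentumDomain α β B) :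
    IsRegularRep α β B f (regularRep f) :=
  Classical.choose_spec (show ∃ F : ℝ → ℂ, IsRegularRep α β B f F from f.2)

/-- The operator `P_B f = (2πi)⁻¹ f'` in `L²(Ω)`, with domain `D(P_B)`. The derivative is that of
any regular representative of `f`; its class in `L²(Ω)` does not depend on the choice. -/
def momentum (α β : ℝ) (B : Matrix (Fin 2) (Fin 2) ℂ) :
    L2Omega α β →ₗ.[ℂ] L2Omega α β where
  domain := momentumDomain α β B
  toFun :=
    (2 * Real.pi * Complex.I : ℂ)⁻¹ •
    { toFun := fun f => (regularRep_spec f).memLp_deriv.toLp (deriv (regularRep f))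
      map_add' := fun f g => by
        rw [← MemLp.toLp_add, MemLp.toLp_eq_toLp_iff]
        exact ((regularRep_spec (f + g)).deriv_ae_eq
          ((regularRep_spec f).add (regularRep_spec g))).trans
          ((regularRep_spec f).deriv_add_ae_eq (regularRep_spec g))
      map_smul' := fun c f => by
        rw [RingHom.id_apply, ← MemLp.toLp_const_smul, MemLp.toLp_eq_toLp_iff, ← deriv_smul_eq]
        exact (regularRep_spec (c • f)).deriv_ae_eq ((regularRep_spec f).smul c) }

/-- `P_B f` is computed from any regular representative of `f`. -/
theorem momentum_apply_ae {α β : ℝ} {B : Matrix (Fin 2) (Fin 2) ℂ}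
    (f : (momentum α β B).domain) {F : ℝ → ℂ} (hF : IsRegularRep α β B f F) :
    momentum α β B f =ᵐ[volume.restrict (Omega α β)]
      fun x => (2 * Real.pi * Complex.I : ℂ)⁻¹ * deriv F x := by
  have h1 := Lp.coeFn_smul (2 * Real.pi * Complex.I : ℂ)⁻¹
    ((regularRep_spec f).memLp_deriv.toLp (deriv (regularRep f)))
  have h2 := (regularRep_spec f).memLp_deriv.coeFn_toLp
  have h3 := (regularRep_spec f).deriv_ae_eq hF
  filter_upwards [h1, h2, h3] with x hx1 hx2 hx3
  exact hx1.trans (by rw [Pi.smul_apply, hx2, hx3, smul_eq_mul])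

/-! ### Generalized eigenfunctions, spectral measure -/

/-- The coefficient `a(ξ)` of the generalized eigenfunction on `(-∞, 0)`. -/
def coeffA (α w φ ψ : ℝ) (ξ : ℝ) : ℂ :=
  (w : ℂ)⁻¹ * e φ * e ξ * (1 - (Real.sqrt (1 - w ^ 2) : ℂ) * e (-ψ + (α - 1) * ξ))

/-- The coefficient `c(ξ)` of the generalized eigenfunction on `(β, ∞)`. -/
def coeffC (α β w θ φ ψ : ℝ) (ξ : ℝ) : ℂ :=
  (w : ℂ)⁻¹ * e (φ - θ) * e (-(β - α) * ξ) *
    (1 - (Real.sqrt (1 - w ^ 2) : ℂ) * e (ψ - (α - 1) * ξ))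

/-- The generalized eigenfunction `ψ_ξ(x)`, equal to `a(ξ) e(ξx)` on `(-∞, 0)`, to `e(ξx)` on
`(1, α)`, to `c(ξ) e(ξx)` on `(β, ∞)`, and to `0` outside `Ω`. -/
def genEigen (α β w θ φ ψ : ℝ) (ξ x : ℝ) : ℂ :=
  ((Iio 0).indicator (fun _ => coeffA α w φ ψ ξ) x + (Ioo 1 α).indicator (fun _ => (1 : ℂ)) x +
    (Ioi β).indicator (fun _ => coeffC α β w θ φ ψ ξ) x) * e (ξ * x)

/-- `m_B(ξ) = |a(ξ)|`. -/
def mB (α w φ ψ : ℝ) (ξ : ℝ) : ℝ := ‖coeffA α w φ ψ ξ‖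

/-- The measure `σ_B(dξ) = m_B(ξ)⁻² dξ` on `ℝ`. -/
def sigmaB (α w φ ψ : ℝ) : Measure ℝ :=
  volume.withDensity fun ξ => ENNReal.ofReal ((mB α w φ ψ ξ ^ 2)⁻¹)

/-! ### Integrals converging in the mean -/

/-- The function `g` is the `L²(μ)`-limit of the functions `u R` as `R → ∞`. -/
def L2Limit (μ : Measure ℝ) (u : ℝ → ℝ → ℂ) (g : ℝ → ℂ) : Prop :=
  Tendsto (fun R : ℝ => eLpNorm (fun y => g y - u R y) 2 μ) atTop (𝓝 0)

/-- `g(ξ) = ⟨ψ_ξ, f⟩ = ∫_Ω conj(ψ_ξ(x)) f(x) dx` in `L²(σ_B)`, the integral being the limit in the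
mean of the integrals over `Ω ∩ [-R, R]`. -/
def IsTransform (α β w θ φ ψ : ℝ) (f g : ℝ → ℂ) : Prop :=
  L2Limit (sigmaB α w φ ψ)
    (fun R ξ => ∫ x in Omega α β ∩ Icc (-R) R, conj (genEigen α β w θ φ ψ ξ x) * f x) g

/-- `f(x) = ∫ g(ξ) ψ_ξ(x) σ_B(dξ)` in `L²(Ω)`, the integral being the limit in the mean of the
integrals over `[-R, R]`. -/
def IsExpansion (α β w θ φ ψ : ℝ) (g f : ℝ → ℂ) : Prop :=
  L2Limit (volume.restrict (Omega α β))
    (fun R x => ∫ ξ in Icc (-R) R, g ξ * genEigen α β w θ φ ψ ξ x ∂(sigmaB α w φ ψ)) f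

end TwoIntervals

end

/-!
The operator `V_B` factors through the time domain. Write `s = √(1 - w²)`, `b = s e(ψ)`, let `T` be
the translation to the right by `α - 1` on `L²(ℝ)`, so that the Fourier transform turns `T` into
multiplication by `z = e(-(α - 1)ξ)`. Then `conj a(ξ) = w⁻¹ e(-φ) e(-ξ) (1 - b z)` and
`conj c(ξ) = w⁻¹ e(θ - φ) e((β - 1)ξ) (z - b̄)`. Hence, if `f₁, f₂, f₃` are the restrictions of `f`
to `(-∞, 0)`, `(1, α)`, `(β, ∞)`, and if `k` and `p` are `e(φ) f₂` and `e(θ) f₃` moved to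
`(0, α - 1)` and to `(0, ∞)`, the pairing `⟨ψ_ξ, f⟩` is `conj a(ξ)` times the Fourier transform of
`f₁ + w (1 - bT)⁻¹ k + (T - b̄)(1 - bT)⁻¹ p`.
Multiplication by `conj a` is unitary from `L²(dξ)` onto `L²(σ_B)`, and the Fourier transform is
unitary, so unitarity of `V_B` amounts to unitarity of `(f₁, k, p) ↦` this function, from
`L²(-∞, 0) ⊕ L²(0, α - 1) ⊕ L²(0, ∞)` onto `L²(ℝ)`. This is the classical decomposition of
`L²(0, ∞)` by the inner function `(z - b̄)/(1 - bz)`, and it holds for every unitary `T` that maps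
a closed subspace `E` into itself, with `L²(0, α - 1)` replaced by `E ⊖ TE`
(`norm_sq_shift`, `eq_zero_of_orthogonal_shift`, `exists_isometryEquiv_shift`).

Once `V_B` is unitary and given by the pairing on integrable functions
(`exists_isometryEquiv_integral`), the limits in the mean are continuity of `V_B` and of its inverse
along truncations; Fubini's theorem identifies the inverse on truncated functions with the integral
over `[-R, R]` (`expansion_truncLp`). Finally `V_B P_B = ξ V_B` is an integration by parts on
`Ω ∩ [-R, R]`: the boundary terms at `0, 1, α, β` cancel because `ψ_ξ` satisfies the boundary
condition (`boundary_terms_cancel`), and those at `±R` vanish along a suitable sequence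
`R → ∞`, along which moreover the truncated pairings converge almost everywhere
(`transform_momentum`).
-/

namespace TwoIntervals

open scoped InnerProductSpace FourierTransform

/-! ### Unitary operators built from a shift -/

section Shift

variable {H : Type*} [NormedAddCommGroup H] [InnerProductSpace ℂ H]

/-- `(T - b̄) (1 - b T)⁻¹` preserves inner products if `T` is unitary: it is a Blaschke factor
evaluated at `T`. -/
theorem inner_sub_conj_smul (T : H ≃ₗᵢ[ℂ] H) (b : ℂ) (x y : H) :
    ⟪T x - conj b • x, T y - conj b • y⟫_ℂ = ⟪x - b • T x, y - b • T y⟫_ℂ := by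
  simp only [inner_sub_left, inner_sub_right, inner_smul_left, inner_smul_right,
    LinearIsometryEquiv.inner_map_map, Complex.conj_conj]
  ring

theorem norm_sub_conj_smul (T : H ≃ₗᵢ[ℂ] H) (b : ℂ) (x : H) :
    ‖T x - conj b • x‖ = ‖x - b • T x‖ := by
  rw [← sq_eq_sq₀ (norm_nonneg _) (norm_nonneg _), ← inner_self_eq_norm_sq (𝕜 := ℂ),
    ← inner_self_eq_norm_sq (𝕜 := ℂ), inner_sub_conj_smul]

variable [CompleteSpace H]

/-- The operator `(1 - b T)⁻¹`, for a unitary operator `T` and `|b| < 1`. It is defined by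
`Ring.inverse`, so its value is `0` for those `b` for which `1 - b T` is not invertible. -/
noncomputable def neumannInv (T : H ≃ₗᵢ[ℂ] H) (b : ℂ) : H →L[ℂ] H :=
  Ring.inverse (1 - b • (T.toContinuousLinearEquiv : H →L[ℂ] H))

theorem isUnit_one_sub_smul (T : H ≃ₗᵢ[ℂ] H) {b : ℂ} (hb : ‖b‖ < 1) :
    IsUnit (1 - b • (T.toContinuousLinearEquiv : H →L[ℂ] H)) := by
  apply isUnit_one_sub_of_norm_lt_one
  refine lt_of_le_of_lt (ContinuousLinearMap.opNorm_le_bound _ (norm_nonneg b) fun x => ?_) hb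
  simp [norm_smul]

theorem neumannInv_sub (T : H ≃ₗᵢ[ℂ] H) {b : ℂ} (hb : ‖b‖ < 1) (x : H) :
    neumannInv T b x - b • T (neumannInv T b x) = x := by
  have h := Ring.mul_inverse_cancel _ (isUnit_one_sub_smul T hb)
  simpa [neumannInv] using congrArg (fun S : H →L[ℂ] H => S x) h

theorem neumannInv_apply_sub (T : H ≃ₗᵢ[ℂ] H) {b : ℂ} (hb : ‖b‖ < 1) (x : H) :
    neumannInv T b (x - b • T x) = x := by
  have h := Ring.inverse_mul_cancel _ (isUnit_one_sub_smul T hb)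
  have h2 := congrArg (fun S : H →L[ℂ] H => S x) h
  simpa [neumannInv] using h2

variable {N E : Submodule ℂ H} {T : H ≃ₗᵢ[ℂ] H} {b : ℂ}

/-- A subspace `E` with `T E ⊆ E`, which is complemented by an orthogonal subspace `N`, is
invariant under `(1 - b T)⁻¹`. -/
theorem neumannInv_mem (hb : ‖b‖ < 1) (hNE : ∀ n ∈ N, ∀ x ∈ E, ⟪n, x⟫_ℂ = 0)
    (hdec : ∀ x, ∃ n ∈ N, ∃ y ∈ E, x = n + y) (hTE : ∀ x ∈ E, T x ∈ E) {x : H} (hx : x ∈ E) :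
    neumannInv T b x ∈ E := by
  obtain ⟨n, hn, y, hy, hxy⟩ := hdec (neumannInv T b x)
  have h := neumannInv_sub T hb x
  rw [hxy] at h ⊢
  have h1 : n = b • T n + (x + b • T y - y) := by
    rw [map_add, smul_add] at h
    rw [← h]; abel
  have hmem : x + b • T y - y ∈ E :=
    E.sub_mem (E.add_mem hx (E.smul_mem _ (hTE _ hy))) hy
  have h2 : ⟪n, n⟫_ℂ = b * ⟪n, T n⟫_ℂ := by
    conv_lhs => rw [h1, inner_add_right, ← h1, inner_smul_right, hNE n hn _ hmem, add_zero]
  have h3 : ‖n‖ ^ 2 ≤ ‖b‖ * ‖n‖ ^ 2 := by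
    have h4 : ‖⟪n, T n⟫_ℂ‖ ≤ ‖n‖ ^ 2 := by
      simpa [sq] using norm_inner_le_norm (𝕜 := ℂ) n (T n)
    calc ‖n‖ ^ 2 = ‖⟪n, n⟫_ℂ‖ := by rw [inner_self_eq_norm_sq_to_K]; simp
      _ = ‖b‖ * ‖⟪n, T n⟫_ℂ‖ := by rw [h2, norm_mul]
      _ ≤ ‖b‖ * ‖n‖ ^ 2 := by gcongr
  -- the `N`-component of the solution is multiplied by a contraction, hence zero
  have h5 : n = 0 := by
    by_contra hne
    have : 0 < ‖n‖ ^ 2 := by positivity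
    nlinarith
  simpa [h5] using hy

/-- The Pythagorean identity behind the isometry: `N`, `(1 - b T)⁻¹ (E ⊖ T E)` and
`(T - b̄) (1 - b T)⁻¹ E` are mutually orthogonal. -/
theorem norm_sq_shift (hb : ‖b‖ < 1) {w : ℝ} (hw : w ^ 2 + ‖b‖ ^ 2 = 1)
    (hNE : ∀ n ∈ N, ∀ x ∈ E, ⟪n, x⟫_ℂ = 0)
    (hdec : ∀ x, ∃ n ∈ N, ∃ y ∈ E, x = n + y) (hTE : ∀ x ∈ E, T x ∈ E)
    {n k p : H} (hn : n ∈ N) (hk : k ∈ E) (hk' : ∀ x ∈ E, ⟪T x, k⟫_ℂ = 0) (hp : p ∈ E) :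
    ‖n + ((w : ℂ) • neumannInv T b k +
      (T (neumannInv T b p) - conj b • neumannInv T b p))‖ ^ 2 = ‖n‖ ^ 2 + (‖k‖ ^ 2 + ‖p‖ ^ 2) := by
  have hu := neumannInv_mem hb hNE hdec hTE hk
  have hv := neumannInv_mem hb hNE hdec hTE hp
  have eu := neumannInv_sub T hb k
  have ev := neumannInv_sub T hb p
  set u := neumannInv T b k
  set v := neumannInv T b p
  have pyth : ∀ x y : H, ⟪x, y⟫_ℂ = 0 → ‖x + y‖ ^ 2 = ‖x‖ ^ 2 + ‖y‖ ^ 2 := fun x y h => by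
    simpa only [sq] using norm_add_sq_eq_norm_sq_add_norm_sq_of_inner_eq_zero x y h
  have hkT : ∀ x ∈ E, ⟪k, T x⟫_ℂ = 0 := fun x hx => by
    rw [← inner_conj_symm, hk' x hx, map_zero]
  have hun : w ^ 2 * ‖u‖ ^ 2 = ‖k‖ ^ 2 := by
    have h1 : u = k + b • T u := by rw [← eu]; abel
    have h2 : ‖u‖ ^ 2 = ‖k‖ ^ 2 + ‖b • T u‖ ^ 2 := by
      conv_lhs => rw [h1]
      exact pyth _ _ (by rw [inner_smul_right, hkT u hu, mul_zero])
    rw [norm_smul, LinearIsometryEquiv.norm_map, mul_pow] at h2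
    linear_combination h2 + ‖u‖ ^ 2 * hw
  have hcross : ⟪u, T v - conj b • v⟫_ℂ = 0 := by
    have h1 : u = k + b • T u := by rw [← eu]; abel
    have h2 : ⟪u, T v⟫_ℂ = conj b * ⟪u, v⟫_ℂ := by
      conv_lhs => rw [h1]
      rw [inner_add_left, hkT v hv, inner_smul_left, LinearIsometryEquiv.inner_map_map, zero_add]
    rw [inner_sub_right, inner_smul_right, h2, sub_self]
  have hE : (w : ℂ) • u + (T v - conj b • v) ∈ E :=
    E.add_mem (E.smul_mem _ hu) (E.sub_mem (hTE _ hv) (E.smul_mem _ hv))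
  rw [pyth _ _ (hNE n hn _ hE), pyth _ _ (by rw [inner_smul_left, hcross, mul_zero]),
    norm_sub_conj_smul, ev, norm_smul, mul_pow, Complex.norm_real, Real.norm_eq_abs, sq_abs, hun]

/-- `N`, `(1 - b T)⁻¹ (E ⊖ T E)` and `(T - b̄) (1 - b T)⁻¹ E` have
no common orthogonal vector except zero. -/
theorem eq_zero_of_orthogonal_shift (hb : ‖b‖ < 1)
    (hNE : ∀ n ∈ N, ∀ x ∈ E, ⟪n, x⟫_ℂ = 0)
    (hdec : ∀ x, ∃ n ∈ N, ∃ y ∈ E, x = n + y) (hTE : ∀ x ∈ E, T x ∈ E) {y : H}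
    (hyN : ∀ n ∈ N, ⟪n, y⟫_ℂ = 0)
    (hyK : ∀ k ∈ E, (∀ x ∈ E, ⟪T x, k⟫_ℂ = 0) → ⟪neumannInv T b k, y⟫_ℂ = 0)
    (hyE : ∀ p ∈ E, ⟪T (neumannInv T b p) - conj b • neumannInv T b p, y⟫_ℂ = 0) : y = 0 := by
  have memE : ∀ x, (∀ n ∈ N, ⟪n, x⟫_ℂ = 0) → x ∈ E := fun x hx => by
    obtain ⟨n, hn, z, hz, rfl⟩ := hdec x
    have := hx n hn
    rw [inner_add_right, hNE n hn z hz, add_zero, inner_self_eq_zero] at this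
    simpa [this] using hz
  have memN : ∀ x, (∀ z ∈ E, ⟪z, x⟫_ℂ = 0) → x ∈ N := fun x hx => by
    obtain ⟨n, hn, z, hz, rfl⟩ := hdec x
    have := hx z hz
    rw [inner_add_right, ← inner_conj_symm, hNE n hn z hz, map_zero, zero_add,
      inner_self_eq_zero] at this
    simpa [this] using hn
  have hy : y ∈ E := memE y hyN
  -- `v = (T - b̄)⁻¹ y = (1 - b̄ T⁻¹)⁻¹ T⁻¹ y`
  set v := neumannInv T.symm (conj b) (T.symm y) with hvdef
  have hv : T v - conj b • v = y := by
    have h := congrArg T (neumannInv_sub T.symm (b := conj b) (by simpa using hb) (T.symm y))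
    simpa using h
  set q := v - b • T v with hq
  have hqN : q ∈ N := by
    refine memN q fun p hp => ?_
    have h := hyE p hp
    rw [← hv, inner_sub_conj_smul, neumannInv_sub T hb] at h
    exact h
  -- `(1 - b T) y` is orthogonal to `T E`, since it equals `(T - b̄) q` with `q ⟂ E`
  have hh : y - b • T y = T q - conj b • q := by
    rw [← hv, hq]
    simp only [map_sub, map_smul, smul_sub, smul_smul]
    rw [mul_comm b (conj b)]
    abel
  have hyR := hyK (y - b • T y) (E.sub_mem hy (E.smul_mem _ (hTE _ hy))) fun x hx => by
    rw [hh, inner_sub_right, inner_smul_right, LinearIsometryEquiv.inner_map_map,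
      ← inner_conj_symm, hNE q hqN x hx, ← inner_conj_symm (T x), hNE q hqN _ (hTE x hx)]
    simp
  rwa [neumannInv_apply_sub T hb, inner_self_eq_zero] at hyR

/-- Coordinates `x ↦ (A₁ x, A₂ x, A₃ x)` in `N ⊕ (E ⊖ T E) ⊕ E` are turned into a unitary map onto
`H = N ⊕ E`. -/
theorem exists_isometryEquiv_shift {X : Type*} [NormedAddCommGroup X] [NormedSpace ℂ X]
    [CompleteSpace X] (hb : ‖b‖ < 1) {w : ℝ} (hw0 : w ≠ 0) (hw : w ^ 2 + ‖b‖ ^ 2 = 1)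
    (hNE : ∀ n ∈ N, ∀ x ∈ E, ⟪n, x⟫_ℂ = 0)
    (hdec : ∀ x, ∃ n ∈ N, ∃ y ∈ E, x = n + y) (hTE : ∀ x ∈ E, T x ∈ E)
    (A₁ A₂ A₃ : X →ₗ[ℂ] H) (h₁ : ∀ x, A₁ x ∈ N) (h₂ : ∀ x, A₂ x ∈ E)
    (h₂' : ∀ x, ∀ y ∈ E, ⟪T y, A₂ x⟫_ℂ = 0) (h₃ : ∀ x, A₃ x ∈ E)
    (hnorm : ∀ x, ‖x‖ ^ 2 = ‖A₁ x‖ ^ 2 + (‖A₂ x‖ ^ 2 + ‖A₃ x‖ ^ 2))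
    (s₁ : ∀ n ∈ N, ∃ x, A₁ x = n ∧ A₂ x = 0 ∧ A₃ x = 0)
    (s₂ : ∀ k ∈ E, (∀ y ∈ E, ⟪T y, k⟫_ℂ = 0) → ∃ x, A₁ x = 0 ∧ A₂ x = k ∧ A₃ x = 0)
    (s₃ : ∀ p ∈ E, ∃ x, A₁ x = 0 ∧ A₂ x = 0 ∧ A₃ x = p) :
    ∃ U : X ≃ₗᵢ[ℂ] H, ∀ x, U x = A₁ x + ((w : ℂ) • neumannInv T b (A₂ x) +
      (T (neumannInv T b (A₃ x)) - conj b • neumannInv T b (A₃ x))) := by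
  let R : H →ₗ[ℂ] H := (neumannInv T b : H →L[ℂ] H)
  let U₀ : X →ₗ[ℂ] H := A₁ + ((w : ℂ) • R ∘ₗ A₂ +
    (T.toLinearEquiv.toLinearMap ∘ₗ R ∘ₗ A₃ - conj b • R ∘ₗ A₃))
  have hU₀ : ∀ x, U₀ x = A₁ x + ((w : ℂ) • neumannInv T b (A₂ x) +
      (T (neumannInv T b (A₃ x)) - conj b • neumannInv T b (A₃ x))) := fun x => rfl
  let U₁ : X →ₗᵢ[ℂ] H := ⟨U₀, fun x => by
    rw [← sq_eq_sq₀ (norm_nonneg _) (norm_nonneg _), hU₀,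
      norm_sq_shift hb hw hNE hdec hTE (h₁ x) (h₂ x) (h₂' x) (h₃ x), hnorm]⟩
  have hsurj : Function.Surjective U₁ := by
    have hcl : IsClosed (LinearMap.range U₀ : Set H) := by
      have := U₁.isometry.isClosedEmbedding.isClosed_range
      simpa using! this
    have : CompleteSpace (LinearMap.range U₀) := hcl.completeSpace_coe
    have hbot : (LinearMap.range U₀)ᗮ = ⊥ := by
      rw [Submodule.eq_bot_iff]
      intro y hy
      have hy' : ∀ x, ⟪U₀ x, y⟫_ℂ = 0 := fun x =>
        (Submodule.mem_orthogonal _ _).1 hy _ (LinearMap.mem_range_self U₀ x)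
      refine eq_zero_of_orthogonal_shift hb hNE hdec hTE (fun n hn => ?_) (fun k hk hk' => ?_)
        (fun p hp => ?_)
      · obtain ⟨x, e₁, e₂, e₃⟩ := s₁ n hn
        simpa [hU₀, e₁, e₂, e₃] using hy' x
      · obtain ⟨x, e₁, e₂, e₃⟩ := s₂ k hk hk'
        simpa [hU₀, e₁, e₂, e₃, inner_smul_left, hw0] using hy' x
      · obtain ⟨x, e₁, e₂, e₃⟩ := s₃ p hp
        simpa [hU₀, e₁, e₂, e₃] using hy' x
    have htop : LinearMap.range U₀ = ⊤ := Submodule.orthogonal_eq_bot_iff.1 hbot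
    exact LinearMap.range_eq_top.1 htop
  exact ⟨LinearIsometryEquiv.ofSurjective U₁ hsurj, fun x => hU₀ x⟩

end Shift

/-! ### Multiplication, translation and Fourier transform on `L²(ℝ)` -/

section Multiplication

variable {μ ν : Measure ℝ} {m : ℝ → ℂ}

/-- Multiplication by `z` is compensated by the weight `|z|⁻²`. -/
theorem enorm_sq_withDensity_weight {z u : ℂ} (hz : z ≠ 0) :
    ENNReal.ofReal ((‖z‖ ^ 2)⁻¹) * ‖z * u‖ₑ ^ (2 : ℝ) = ‖u‖ₑ ^ (2 : ℝ) := by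
  have hz' : 0 < ‖z‖ := norm_pos_iff.2 hz
  have h : ∀ v : ℂ, ‖v‖ₑ ^ (2 : ℝ) = ENNReal.ofReal (‖v‖ ^ 2) := fun v => by
    rw [← ofReal_norm, ENNReal.ofReal_rpow_of_nonneg (norm_nonneg _) (by norm_num)]
    norm_num
  rw [h, h, ← ENNReal.ofReal_mul (by positivity), norm_mul]
  congr 1
  field_simp

theorem eLpNorm_mul_withDensity (hm : Measurable m) (h0 : ∀ x, m x ≠ 0)
    (hν : ν = μ.withDensity fun x => ENNReal.ofReal ((‖m x‖ ^ 2)⁻¹)) (f : ℝ → ℂ) :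
    eLpNorm (fun x => m x * f x) 2 ν = eLpNorm f 2 μ := by
  rw [eLpNorm_eq_lintegral_rpow_enorm_toReal (by norm_num) (by norm_num),
    eLpNorm_eq_lintegral_rpow_enorm_toReal (by norm_num) (by norm_num), hν,
    lintegral_withDensity_eq_lintegral_mul_non_measurable _ (by fun_prop)
      (Eventually.of_forall fun x => ENNReal.ofReal_lt_top)]
  simp_rw [Pi.mul_apply, ENNReal.toReal_ofNat, enorm_sq_withDensity_weight (h0 _)]

theorem absolutelyContinuous_weight
    (hν : ν = μ.withDensity fun x => ENNReal.ofReal ((‖m x‖ ^ 2)⁻¹)) : ν ≪ μ :=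
  hν ▸ withDensity_absolutelyContinuous _ _

theorem absolutelyContinuous_weight' (hm : Measurable m) (h0 : ∀ x, m x ≠ 0)
    (hν : ν = μ.withDensity fun x => ENNReal.ofReal ((‖m x‖ ^ 2)⁻¹)) : μ ≪ ν := by
  rw [hν]
  refine withDensity_absolutelyContinuous' (by fun_prop) (Eventually.of_forall fun x => ?_)
  have : 0 < ‖m x‖ := norm_pos_iff.2 (h0 x)
  simp only [ne_eq, ENNReal.ofReal_eq_zero, not_le]
  positivity

theorem memLp_mul_withDensity (hm : Measurable m) (h0 : ∀ x, m x ≠ 0)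
    (hν : ν = μ.withDensity fun x => ENNReal.ofReal ((‖m x‖ ^ 2)⁻¹)) {f : ℝ → ℂ}
    (hf : MemLp f 2 μ) : MemLp (fun x => m x * f x) 2 ν := by
  refine ⟨hm.aestronglyMeasurable.mul
    (hf.1.mono_ac (absolutelyContinuous_weight hν)), ?_⟩
  rw [eLpNorm_mul_withDensity hm h0 hν]
  exact hf.2

/-- Multiplication by a nowhere vanishing function `m`, as a unitary operator from `L²(μ)` onto
`L²(|m|⁻² μ)`. -/
theorem exists_isometryEquiv_mul (hm : Measurable m) (h0 : ∀ x, m x ≠ 0)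
    (hν : ν = μ.withDensity fun x => ENNReal.ofReal ((‖m x‖ ^ 2)⁻¹)) :
    ∃ M : Lp ℂ 2 μ ≃ₗᵢ[ℂ] Lp ℂ 2 ν, ∀ f, M f =ᵐ[ν] fun x => m x * f x := by
  have hac := absolutelyContinuous_weight hν
  let M₀ : Lp ℂ 2 μ →ₗ[ℂ] Lp ℂ 2 ν :=
    { toFun := fun f => (memLp_mul_withDensity hm h0 hν (Lp.memLp f)).toLp _
      map_add' := fun f g => by
        rw [← MemLp.toLp_add, MemLp.toLp_eq_toLp_iff]
        filter_upwards [hac.ae_le (Lp.coeFn_add f g)] with x hx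
        rw [hx, Pi.add_apply, Pi.add_apply, mul_add]
      map_smul' := fun c f => by
        rw [RingHom.id_apply, ← MemLp.toLp_const_smul, MemLp.toLp_eq_toLp_iff]
        filter_upwards [hac.ae_le (Lp.coeFn_smul c f)] with x hx
        simp only [hx, Pi.smul_apply, smul_eq_mul]
        ring }
  have hM₀ : ∀ f, M₀ f =ᵐ[ν] fun x => m x * f x := fun f =>
    (memLp_mul_withDensity hm h0 hν (Lp.memLp f)).coeFn_toLp
  let M₁ : Lp ℂ 2 μ →ₗᵢ[ℂ] Lp ℂ 2 ν := ⟨M₀, fun f => by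
    rw [Lp.norm_def, eLpNorm_congr_ae (hM₀ f), eLpNorm_mul_withDensity hm h0 hν, ← Lp.norm_def]⟩
  refine ⟨LinearIsometryEquiv.ofSurjective M₁ fun g => ?_, hM₀⟩
  have hmem : MemLp (fun x => (m x)⁻¹ * g x) 2 μ := by
    refine ⟨hm.inv.aestronglyMeasurable.mul
      ((Lp.aestronglyMeasurable g).mono_ac (absolutelyContinuous_weight' hm h0 hν)), ?_⟩
    rw [← eLpNorm_mul_withDensity hm h0 hν]
    simpa [h0] using (Lp.memLp g).2
  refine ⟨hmem.toLp _, Lp.ext ?_⟩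
  filter_upwards [hM₀ (hmem.toLp _), hac.ae_le hmem.coeFn_toLp] with x hx hx'
  exact hx.trans (by rw [hx', mul_inv_cancel_left₀ (h0 x)])

end Multiplication

theorem e_add (x y : ℝ) : e (x + y) = e x * e y := by
  rw [e, e, e, ← Complex.exp_add]; congr 1; push_cast; ring

theorem e_zero : e 0 = 1 := by simp [e]

theorem e_neg (x : ℝ) : e (-x) = (e x)⁻¹ := by
  rw [e, e, ← Complex.exp_neg]; congr 1; push_cast; ring

theorem norm_e (x : ℝ) : ‖e x‖ = 1 := by
  rw [e, show (2 * Real.pi * Complex.I * x : ℂ) = ((2 * Real.pi * x : ℝ) : ℂ) * Complex.I by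
    push_cast; ring]
  exact Complex.norm_exp_ofReal_mul_I _

theorem e_ne_zero (x : ℝ) : e x ≠ 0 := Complex.exp_ne_zero _

theorem conj_e (x : ℝ) : conj (e x) = e (-x) := by
  rw [e, e, ← Complex.exp_conj]; congr 1; simp [Complex.conj_ofNat]

theorem continuous_e : Continuous e := by unfold e; fun_prop

/-- The translation `f ↦ f(· + c)` of `L²(ℝ)`. -/
noncomputable def translate (c : ℝ) :
    Lp ℂ 2 (volume : Measure ℝ) ≃ₗᵢ[ℂ] Lp ℂ 2 (volume : Measure ℝ) :=
  LinearIsometryEquiv.ofSurjective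
    (Lp.compMeasurePreservingₗᵢ ℂ (fun x => x + c) (measurePreserving_add_right volume c))
    fun f => ⟨Lp.compMeasurePreserving (fun x => x + -c)
        (measurePreserving_add_right volume (-c)) f,
      by
        change Lp.compMeasurePreserving _ _ (Lp.compMeasurePreserving _ _ f) = f
        rw [← Lp.compMeasurePreserving_comp_apply]
        have h : ((fun x => x + -c) ∘ fun x => x + c) = (id : ℝ → ℝ) := by funext x; simp
        simp only [h]
        exact Lp.compMeasurePreserving_id_apply f⟩

theorem coeFn_translate (c : ℝ) (f : Lp ℂ 2 (volume : Measure ℝ)) :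
    translate c f =ᵐ[volume] fun x => f (x + c) :=
  Lp.coeFn_compMeasurePreserving f (measurePreserving_add_right volume c)

theorem real_fourier_eq_integral (f : ℝ → ℂ) (ξ : ℝ) : 𝓕 f ξ = ∫ x, e (-(ξ * x)) * f x := by
  rw [Real.fourier_eq]
  congr 1
  funext x
  rw [Circle.smul_def, Real.fourierChar_apply, smul_eq_mul, e]
  congr 2
  simp
  ring

/-- For integrable `f ∈ L²(ℝ)` the Fourier transform on `L²(ℝ)` is given by the integral. -/
theorem fourier_ae_eq_integral (f : Lp ℂ 2 (volume : Measure ℝ)) (hf : Integrable f) :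
    (𝓕 f : Lp ℂ 2 (volume : Measure ℝ)) =ᵐ[volume] fun ξ => ∫ x, e (-(ξ * x)) * f x := by
  have h1 : (𝓕 f : Lp ℂ 2 (volume : Measure ℝ)) =ᵐ[volume] 𝓕 (f : ℝ → ℂ) := by
    refine ae_eq_of_integral_contDiff_smul_eq
      ((Lp.memLp _).locallyIntegrable (by norm_num))
      (VectorFourier.fourierIntegral_continuous (L := innerₗ ℝ) Real.continuous_fourierChar
        continuous_inner hf).locallyIntegrable fun g hg hgc => ?_
    let G : SchwartzMap ℝ ℂ := HasCompactSupport.toSchwartzMap (f := fun x => (g x : ℂ))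
      (hgc.comp_left (g := fun t : ℝ => (t : ℂ)) (by simp)) (Complex.ofRealCLM.contDiff.comp hg)
    have hG : ∀ x, G x = g x := fun x => rfl
    have e1 := congrArg (fun D : TemperedDistribution ℝ ℂ => D G)
      (Lp.fourier_toTemperedDistribution_eq f)
    simp only [TemperedDistribution.fourier_apply, Lp.toTemperedDistribution_apply] at e1
    have e2 := VectorFourier.integral_fourierIntegral_smul_eq_flip (L := innerₗ ℝ)
      (μ := volume) (ν := volume) Real.continuous_fourierChar continuous_inner G.integrable hf
    rw [flip_innerₗ] at e2
    have e3 : ∫ x, (𝓕 G) x • f x = ∫ x, G x • 𝓕 (f : ℝ → ℂ) x := e2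
    rw [e1] at e3
    simpa [hG] using e3
  filter_upwards [h1] with ξ hξ
  rw [hξ, real_fourier_eq_integral]

theorem fourier_translate_of_integrable (c : ℝ) (f : Lp ℂ 2 (volume : Measure ℝ))
    (hf : Integrable f) :
    (𝓕 (translate c f) : Lp ℂ 2 (volume : Measure ℝ)) =ᵐ[volume]
      fun ξ => e (c * ξ) * (𝓕 f : Lp ℂ 2 (volume : Measure ℝ)) ξ := by
  have h1 : Integrable (translate c f) :=
    (integrable_congr (coeFn_translate c f)).2 (hf.comp_add_right c)
  filter_upwards [fourier_ae_eq_integral f hf, fourier_ae_eq_integral _ h1] with ξ h2 h3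
  rw [h2, h3, ← integral_const_mul,
    ← integral_add_right_eq_self (fun x => e (c * ξ) * (e (-(ξ * x)) * f x)) c]
  refine integral_congr_ae ?_
  filter_upwards [coeFn_translate c f] with x hx
  rw [hx, ← mul_assoc, ← e_add]
  congr 2
  ring

/-- The Fourier transform intertwines translations with multiplication by characters. -/
theorem fourier_translate (c : ℝ) (f : Lp ℂ 2 (volume : Measure ℝ)) :
    (𝓕 (translate c f) : Lp ℂ 2 (volume : Measure ℝ)) =ᵐ[volume]
      fun ξ => e (c * ξ) * (𝓕 f : Lp ℂ 2 (volume : Measure ℝ)) ξ := by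
  obtain ⟨M, hM⟩ := exists_isometryEquiv_mul (μ := volume) (ν := volume)
    (m := fun ξ => e (c * ξ)) (continuous_e.comp (continuous_const.mul continuous_id)).measurable
    (fun ξ => e_ne_zero _) (by simp [norm_e])
  suffices h : ∀ f : Lp ℂ 2 (volume : Measure ℝ), 𝓕 (translate c f) = M (𝓕 f) by
    rw [h]; exact hM _
  intro f
  refine DenseRange.induction_on (p := fun f : Lp ℂ 2 (volume : Measure ℝ) =>
    𝓕 (translate c f) = M (𝓕 f))
    (SchwartzMap.denseRange_toLpCLM (E := ℝ) (F := ℂ) (p := 2) (μ := volume)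
      ENNReal.ofNat_ne_top) f ?_ fun g => ?_
  · exact isClosed_eq
      ((Lp.fourierTransformₗᵢ ℝ ℂ).continuous.comp (translate c).continuous)
      (M.continuous.comp (Lp.fourierTransformₗᵢ ℝ ℂ).continuous)
  · have hg : Integrable (g.toLp 2 : Lp ℂ 2 (volume : Measure ℝ)) :=
      (integrable_congr (g.coeFn_toLp 2 volume)).2 g.integrable
    exact Lp.ext ((fourier_translate_of_integrable c _ hg).trans (hM _).symm)

/-! ### Functions in `L²(ℝ)` supported on a set -/

theorem norm_sq_eq_integral {μ : Measure ℝ} (f : Lp ℂ 2 μ) : ‖f‖ ^ 2 = ∫ x, ‖f x‖ ^ 2 ∂μ := by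
  have h : ((‖f‖ ^ 2 : ℝ) : ℂ) = ((∫ x, ‖f x‖ ^ 2 ∂μ : ℝ) : ℂ) := by
    rw [← integral_complex_ofReal]
    push_cast
    have := inner_self_eq_norm_sq_to_K (𝕜 := ℂ) f
    rw [L2.inner_def] at this
    simpa [inner_self_eq_norm_sq_to_K] using this.symm
  exact_mod_cast h

/-- The elements of `L²(ℝ)` which vanish almost everywhere outside `S`. -/
def supportedOn (S : Set ℝ) : Submodule ℂ (Lp ℂ 2 (volume : Measure ℝ)) where
  carrier := {f | ∀ᵐ x, x ∉ S → f x = 0}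
  add_mem' {f g} hf hg := by
    filter_upwards [hf, hg, Lp.coeFn_add f g] with x h1 h2 h3 hx
    rw [h3, Pi.add_apply, h1 hx, h2 hx, add_zero]
  zero_mem' := by
    filter_upwards [Lp.coeFn_zero ℂ 2 (volume : Measure ℝ)] with x h1 _
    rw [h1, Pi.zero_apply]
  smul_mem' c f hf := by
    filter_upwards [hf, Lp.coeFn_smul c f] with x h1 h2 hx
    rw [h2, Pi.smul_apply, h1 hx, smul_zero]

variable {S S' D : Set ℝ} {f g : Lp ℂ 2 (volume : Measure ℝ)}

theorem mem_supportedOn : f ∈ supportedOn S ↔ ∀ᵐ x, x ∉ S → f x = 0 := Iff.rfl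

theorem supportedOn_congr_ae (h : S =ᵐ[volume] S') : supportedOn S = supportedOn S' := by
  have key : ∀ {A B : Set ℝ}, A =ᵐ[volume] B → supportedOn A ≤ supportedOn B :=
    fun {A B} h f hf => by
      rw [mem_supportedOn] at hf ⊢
      filter_upwards [hf, h.mem_iff] with x h1 h2 hx
      exact h1 fun hA => hx (h2.1 hA)
  exact le_antisymm (key h) (key h.symm)

theorem mem_supportedOn_inter (h : f ∈ supportedOn S) (h' : f ∈ supportedOn S') :
    f ∈ supportedOn (S ∩ S') := by
  rw [mem_supportedOn] at h h' ⊢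
  filter_upwards [h, h'] with x h1 h2 hx
  by_cases hS : x ∈ S
  · exact h2 fun hS' => hx ⟨hS, hS'⟩
  · exact h1 hS

theorem inner_eq_zero_of_supportedOn (hf : f ∈ supportedOn S) (hg : g ∈ supportedOn S')
    (hd : Disjoint S S') : ⟪f, g⟫_ℂ = 0 := by
  rw [L2.inner_def]
  refine integral_eq_zero_of_ae ?_
  rw [mem_supportedOn] at hf hg
  filter_upwards [hf, hg] with x h1 h2
  by_cases hS : x ∈ S
  · simp [h2 (hd.notMem_of_mem_left hS)]
  · simp [h1 hS]

theorem exists_supportedOn_add (hS : MeasurableSet S) (f : Lp ℂ 2 (volume : Measure ℝ)) :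
    ∃ n ∈ supportedOn S, ∃ y ∈ supportedOn Sᶜ, f = n + y := by
  have h1 := (Lp.memLp f).indicator hS
  have h2 := (Lp.memLp f).indicator hS.compl
  refine ⟨h1.toLp _, ?_, h2.toLp _, ?_, Lp.ext ?_⟩
  · rw [mem_supportedOn]
    filter_upwards [h1.coeFn_toLp] with x hx hxS
    rw [hx, indicator_of_notMem hxS]
  · rw [mem_supportedOn]
    filter_upwards [h2.coeFn_toLp] with x hx hxS
    rw [hx, indicator_of_notMem hxS]
  · filter_upwards [Lp.coeFn_add (h1.toLp _) (h2.toLp _), h1.coeFn_toLp, h2.coeFn_toLp]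
      with x hx h1 h2
    rw [hx, Pi.add_apply, h1, h2]
    exact (congrFun (indicator_self_add_compl S f) x).symm

theorem mem_supportedOn_compl (hS : MeasurableSet S) (hf : ∀ g ∈ supportedOn S, ⟪g, f⟫_ℂ = 0) :
    f ∈ supportedOn Sᶜ := by
  obtain ⟨n, hn, y, hy, rfl⟩ := exists_supportedOn_add hS f
  have h := hf n hn
  rw [inner_add_right, inner_eq_zero_of_supportedOn hn hy disjoint_compl_right, add_zero,
    inner_self_eq_zero] at h
  simpa [h] using hy

theorem translate_mem_supportedOn {c : ℝ} (hf : f ∈ supportedOn S)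
    (h : ∀ x, x + c ∈ S → x ∈ S') : translate c f ∈ supportedOn S' := by
  rw [mem_supportedOn] at hf ⊢
  filter_upwards [coeFn_translate c f,
    (measurePreserving_add_right volume c).quasiMeasurePreserving.ae hf] with x h1 h2 hx
  rw [h1]
  exact h2 fun h3 => hx (h x h3)

theorem translate_translate_neg (c : ℝ) (f : Lp ℂ 2 (volume : Measure ℝ)) :
    translate c (translate (-c) f) = f := by
  refine Lp.ext ?_
  filter_upwards [coeFn_translate c (translate (-c) f),
    (measurePreserving_add_right volume c).quasiMeasurePreserving.ae (coeFn_translate (-c) f)]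
    with x h1 h2
  rw [h1, h2]
  simp

theorem memLp_indicator_restrict (hS : MeasurableSet S) (hSD : S ⊆ D)
    (f : Lp ℂ 2 (volume.restrict D)) : MemLp (S.indicator f) 2 (volume : Measure ℝ) :=
  (memLp_indicator_iff_restrict hS).2 ((Lp.memLp f).mono_measure (Measure.restrict_mono hSD le_rfl))

theorem indicator_ae_eq_of_restrict {F G : ℝ → ℂ} (hS : MeasurableSet S) (hSD : S ⊆ D)
    (h : F =ᵐ[volume.restrict D] G) : S.indicator F =ᵐ[volume] S.indicator G :=
  (ae_eq_restrict_iff_indicator_ae_eq hS).1 (ae_mono (Measure.restrict_mono hSD le_rfl) h)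

/-- The map `L²(D) → L²(ℝ)`, `f ↦ χ_S f`, for `S ⊆ D`. -/
noncomputable def cutoff (hS : MeasurableSet S) (hSD : S ⊆ D) :
    Lp ℂ 2 (volume.restrict D) →ₗ[ℂ] Lp ℂ 2 (volume : Measure ℝ) where
  toFun f := (memLp_indicator_restrict hS hSD f).toLp _
  map_add' f g := by
    rw [← MemLp.toLp_add, MemLp.toLp_eq_toLp_iff, ← indicator_add']
    exact indicator_ae_eq_of_restrict hS hSD (Lp.coeFn_add f g)
  map_smul' c f := by
    rw [RingHom.id_apply, ← MemLp.toLp_const_smul, MemLp.toLp_eq_toLp_iff]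
    refine (indicator_ae_eq_of_restrict hS hSD (Lp.coeFn_smul c f)).trans (ae_of_all _ fun x => ?_)
    by_cases h : x ∈ S <;> simp [h]

theorem coeFn_cutoff (hS : MeasurableSet S) (hSD : S ⊆ D) (f : Lp ℂ 2 (volume.restrict D)) :
    cutoff hS hSD f =ᵐ[volume] S.indicator f :=
  (memLp_indicator_restrict hS hSD f).coeFn_toLp

theorem cutoff_mem_supportedOn (hS : MeasurableSet S) (hSD : S ⊆ D)
    (f : Lp ℂ 2 (volume.restrict D)) : cutoff hS hSD f ∈ supportedOn S := by
  rw [mem_supportedOn]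
  filter_upwards [coeFn_cutoff hS hSD f] with x hx hxS
  rw [hx, indicator_of_notMem hxS]

theorem norm_sq_cutoff (hS : MeasurableSet S) (hSD : S ⊆ D) (f : Lp ℂ 2 (volume.restrict D)) :
    ‖cutoff hS hSD f‖ ^ 2 = ∫ x in S, ‖f x‖ ^ 2 := by
  rw [norm_sq_eq_integral, ← integral_indicator hS]
  refine integral_congr_ae ?_
  filter_upwards [coeFn_cutoff hS hSD f] with x hx
  rw [hx]
  by_cases h : x ∈ S <;> simp [h]

/-- An element of `L²(ℝ)` supported on `S ⊆ D` comes from an element of `L²(D)`. -/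
theorem exists_cutoff_eq (hS : MeasurableSet S) (hSD : S ⊆ D)
    (hf : f ∈ supportedOn S) :
    ∃ u : Lp ℂ 2 (volume.restrict D), cutoff hS hSD u = f ∧
      ∀ (A : Set ℝ) (hA : MeasurableSet A) (hAD : A ⊆ D), Disjoint S A → cutoff hA hAD u = 0 := by
  have hm : MemLp f 2 (volume.restrict D) := (Lp.memLp f).restrict D
  have key : ∀ (A : Set ℝ) (hA : MeasurableSet A) (hAD : A ⊆ D),
      cutoff hA hAD (hm.toLp _) =ᵐ[volume] A.indicator f := fun A hA hAD =>
    (coeFn_cutoff hA hAD _).trans (indicator_ae_eq_of_restrict hA hAD hm.coeFn_toLp)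
  rw [mem_supportedOn] at hf
  refine ⟨hm.toLp _, Lp.ext ?_, fun A hA hAD hd => Lp.ext ?_⟩
  · filter_upwards [key S hS hSD, hf] with x h1 h2
    rw [h1]
    by_cases h : x ∈ S
    · simp [h]
    · simp [h, h2 h]
  · filter_upwards [key A hA hAD, hf, Lp.coeFn_zero ℂ 2 (volume : Measure ℝ)] with x h1 h2 h3
    rw [h1, h3]
    by_cases h : x ∈ A
    · simp [h, h2 (hd.notMem_of_mem_right h)]
    · simp [h]

/-! ### Generalized eigenfunctions -/

section Coefficients

variable {α β w θ φ ψ : ℝ}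

theorem sqrt_one_sub_sq_lt_one (hw0 : 0 < w) : Real.sqrt (1 - w ^ 2) < 1 := by
  rw [Real.sqrt_lt' one_pos]
  nlinarith

theorem norm_sqrt_mul_e (w x : ℝ) :
    ‖(Real.sqrt (1 - w ^ 2) : ℂ) * e x‖ = Real.sqrt (1 - w ^ 2) := by
  rw [norm_mul, norm_e, mul_one, Complex.norm_real, Real.norm_eq_abs,
    abs_of_nonneg (Real.sqrt_nonneg _)]

theorem one_sub_sqrt_mul_e_ne_zero (hw0 : 0 < w) (x : ℝ) :
    1 - (Real.sqrt (1 - w ^ 2) : ℂ) * e x ≠ 0 := fun h => by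
  have h1 := congrArg norm (sub_eq_zero.1 h)
  rw [norm_sqrt_mul_e, norm_one] at h1
  exact (sqrt_one_sub_sq_lt_one hw0).ne h1.symm

theorem coeffA_ne_zero (hw0 : 0 < w) (ξ : ℝ) : coeffA α w φ ψ ξ ≠ 0 :=
  mul_ne_zero (mul_ne_zero (mul_ne_zero (inv_ne_zero (by exact_mod_cast hw0.ne')) (e_ne_zero _))
    (e_ne_zero _)) (one_sub_sqrt_mul_e_ne_zero hw0 _)

theorem norm_one_sub_sqrt_mul_e_le (hw0 : 0 < w) (x : ℝ) :
    ‖1 - (Real.sqrt (1 - w ^ 2) : ℂ) * e x‖ ≤ 2 := by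
  refine (norm_sub_le _ _).trans ?_
  rw [norm_sqrt_mul_e, norm_one]
  linarith [sqrt_one_sub_sq_lt_one hw0]

theorem norm_coeffA_le (hw0 : 0 < w) (ξ : ℝ) : ‖coeffA α w φ ψ ξ‖ ≤ w⁻¹ * 2 := by
  rw [coeffA, norm_mul, norm_mul, norm_mul, norm_e, norm_e, norm_inv, Complex.norm_real,
    Real.norm_eq_abs, abs_of_pos hw0, mul_one, mul_one]
  have := norm_one_sub_sqrt_mul_e_le hw0 (-ψ + (α - 1) * ξ)
  gcongr

theorem norm_coeffC_le (hw0 : 0 < w) (ξ : ℝ) : ‖coeffC α β w θ φ ψ ξ‖ ≤ w⁻¹ * 2 := by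
  rw [coeffC, norm_mul, norm_mul, norm_mul, norm_e, norm_e, norm_inv, Complex.norm_real,
    Real.norm_eq_abs, abs_of_pos hw0, mul_one, mul_one]
  have := norm_one_sub_sqrt_mul_e_le hw0 (ψ - (α - 1) * ξ)
  gcongr

theorem continuous_coeffA : Continuous (coeffA α w φ ψ) := by
  have := continuous_e
  unfold coeffA
  fun_prop

theorem continuous_coeffC : Continuous (coeffC α β w θ φ ψ) := by
  have := continuous_e
  unfold coeffC
  fun_prop

theorem sigmaB_eq : sigmaB α w φ ψ =
    volume.withDensity fun ξ => ENNReal.ofReal ((‖conj (coeffA α w φ ψ ξ)‖ ^ 2)⁻¹) := by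
  simp [sigmaB, mB]

theorem Iio_subset_Omega : Iio 0 ⊆ Omega α β := fun _ h => Or.inl (Or.inl h)

theorem Ioo_subset_Omega : Ioo 1 α ⊆ Omega α β := fun _ h => Or.inl (Or.inr h)

theorem Ioi_subset_Omega : Ioi β ⊆ Omega α β := fun _ h => Or.inr h

theorem setIntegral_Omega {E : Type*} [NormedAddCommGroup E] [NormedSpace ℝ E]
    (hα : 1 < α) (hβ : α < β) {h : ℝ → E} {S : Set ℝ} (hS : MeasurableSet S)
    (hh : IntegrableOn h (Omega α β ∩ S)) :
    ∫ x in Omega α β ∩ S, h x =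
      (∫ x in Iio 0 ∩ S, h x) + ((∫ x in Ioo 1 α ∩ S, h x) + ∫ x in Ioi β ∩ S, h x) := by
  have h1 := hh.mono_set (inter_subset_inter_left S (Iio_subset_Omega (α := α) (β := β)))
  have h2 := hh.mono_set (inter_subset_inter_left S (Ioo_subset_Omega (α := α) (β := β)))
  have h3 := hh.mono_set (inter_subset_inter_left S (Ioi_subset_Omega (α := α) (β := β)))
  rw [Omega, union_inter_distrib_right, union_inter_distrib_right,
    setIntegral_union _ (measurableSet_Ioi.inter hS) (h1.union h2) h3,
    setIntegral_union _ (measurableSet_Ioo.inter hS) h1 h2, add_assoc]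
  · rw [Set.disjoint_left]
    rintro x ⟨hx1, _⟩ ⟨hx2, _⟩
    simp only [mem_Iio, mem_Ioo] at hx1 hx2
    linarith
  · rw [Set.disjoint_left]
    rintro x (⟨hx1, _⟩ | ⟨hx1, _⟩) ⟨hx2, _⟩ <;> simp only [mem_Iio, mem_Ioo, mem_Ioi] at hx1 hx2 <;>
      linarith

theorem genEigen_of_neg (hα : 1 < α) (hβ : α < β) {x : ℝ} (hx : x ∈ Iio 0) (ξ : ℝ) :
    genEigen α β w θ φ ψ ξ x = coeffA α w φ ψ ξ * e (ξ * x) := by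
  have h1 : x ∉ Ioo 1 α := fun h => by simp only [mem_Iio, mem_Ioo] at hx h; linarith
  have h2 : x ∉ Ioi β := fun h => by simp only [mem_Iio, mem_Ioi] at hx h; linarith
  simp [genEigen, indicator_of_mem hx, indicator_of_notMem h1, indicator_of_notMem h2]

theorem genEigen_of_mem_Ioo (hβ : α < β) {x : ℝ} (hx : x ∈ Ioo 1 α) (ξ : ℝ) :
    genEigen α β w θ φ ψ ξ x = e (ξ * x) := by
  have h1 : x ∉ Iio 0 := fun h => by simp only [mem_Iio, mem_Ioo] at hx h; linarith
  have h2 : x ∉ Ioi β := fun h => by simp only [mem_Ioo, mem_Ioi] at hx h; linarith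
  simp [genEigen, indicator_of_mem hx, indicator_of_notMem h1, indicator_of_notMem h2]

theorem genEigen_of_gt (hα : 1 < α) (hβ : α < β) {x : ℝ} (hx : x ∈ Ioi β) (ξ : ℝ) :
    genEigen α β w θ φ ψ ξ x = coeffC α β w θ φ ψ ξ * e (ξ * x) := by
  have h1 : x ∉ Iio 0 := fun h => by simp only [mem_Iio, mem_Ioi] at hx h; linarith
  have h2 : x ∉ Ioo 1 α := fun h => by simp only [mem_Ioo, mem_Ioi] at hx h; linarith
  simp [genEigen, indicator_of_mem hx, indicator_of_notMem h1, indicator_of_notMem h2]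

theorem norm_genEigen_le (hw0 : 0 < w) (ξ x : ℝ) :
    ‖genEigen α β w θ φ ψ ξ x‖ ≤ w⁻¹ * 2 + 1 + w⁻¹ * 2 := by
  rw [genEigen, norm_mul, norm_e, mul_one]
  refine (norm_add_le _ _).trans (add_le_add ((norm_add_le _ _).trans (add_le_add ?_ ?_)) ?_)
  · exact (norm_indicator_le_norm_self _ _).trans (norm_coeffA_le hw0 ξ)
  · exact (norm_indicator_le_norm_self _ _).trans (by simp)
  · exact (norm_indicator_le_norm_self _ _).trans (norm_coeffC_le hw0 ξ)

theorem measurable_genEigen :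
    Measurable fun p : ℝ × ℝ => genEigen α β w θ φ ψ p.1 p.2 := by
  have h : ∀ (S : Set ℝ) (_ : MeasurableSet S) (c : ℝ → ℂ) (_ : Measurable c),
      Measurable fun p : ℝ × ℝ => S.indicator (fun _ => c p.1) p.2 := fun S hS c hc => by
    have h1 := (hc.comp measurable_fst).indicator (measurable_snd hS : MeasurableSet
      ((Prod.snd : ℝ × ℝ → ℝ) ⁻¹' S))
    exact h1
  unfold genEigen
  refine (((h _ measurableSet_Iio _ continuous_coeffA.measurable).add
    (h _ measurableSet_Ioo _ measurable_const)).add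
    (h _ measurableSet_Ioi _ continuous_coeffC.measurable)).mul ?_
  exact (continuous_e.comp (continuous_fst.mul continuous_snd)).measurable

theorem measurable_genEigen_right (ξ : ℝ) : Measurable (genEigen α β w θ φ ψ ξ) := by
  have h := (measurable_genEigen (α := α) (β := β) (w := w) (θ := θ) (φ := φ) (ψ := ψ)).comp
    (measurable_prodMk_left (x := ξ))
  exact h

theorem integrable_conj_genEigen_mul (hw0 : 0 < w) {μ : Measure ℝ} {f : ℝ → ℂ}
    (hf : Integrable f μ) (ξ : ℝ) :
    Integrable (fun x => conj (genEigen α β w θ φ ψ ξ x) * f x) μ :=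
  hf.bdd_mul (c := w⁻¹ * 2 + 1 + w⁻¹ * 2)
    (Complex.continuous_conj.measurable.comp (measurable_genEigen_right ξ)).aestronglyMeasurable
    (ae_of_all _ fun x => by rw [RCLike.norm_conj]; exact norm_genEigen_le hw0 ξ x)

/-- The pairing with `ψ_ξ` in terms of the Fourier integrals over the components of `Ω`. -/
theorem setIntegral_conj_genEigen (hα : 1 < α) (hβ : α < β) (hw0 : 0 < w) {f : ℝ → ℂ} {S : Set ℝ}
    (hS : MeasurableSet S) (hf : IntegrableOn f (Omega α β ∩ S)) (ξ : ℝ) :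
    ∫ x in Omega α β ∩ S, conj (genEigen α β w θ φ ψ ξ x) * f x =
      conj (coeffA α w φ ψ ξ) * (∫ x in Iio 0 ∩ S, e (-(ξ * x)) * f x) +
        ((∫ x in Ioo 1 α ∩ S, e (-(ξ * x)) * f x) +
          conj (coeffC α β w θ φ ψ ξ) * ∫ x in Ioi β ∩ S, e (-(ξ * x)) * f x) := by
  rw [setIntegral_Omega hα hβ hS (integrable_conj_genEigen_mul hw0 hf ξ), ← integral_const_mul,
    ← integral_const_mul]
  congr 1
  · refine setIntegral_congr_fun (measurableSet_Iio.inter hS) fun x hx => ?_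
    simp only [genEigen_of_neg hα hβ hx.1, map_mul, conj_e, mul_assoc]
  congr 1
  · refine setIntegral_congr_fun (measurableSet_Ioo.inter hS) fun x hx => ?_
    simp only [genEigen_of_mem_Ioo hβ hx.1, conj_e]
  · refine setIntegral_congr_fun (measurableSet_Ioi.inter hS) fun x hx => ?_
    simp only [genEigen_of_gt hα hβ hx.1, map_mul, conj_e, mul_assoc]

theorem conj_coeffA (ξ : ℝ) : conj (coeffA α w φ ψ ξ) =
    (w : ℂ)⁻¹ * e (-φ) * e (-ξ) * (1 - Real.sqrt (1 - w ^ 2) * e ψ * e (-(α - 1) * ξ)) := by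
  rw [coeffA]
  simp only [map_mul, map_sub, map_one, map_inv₀, conj_e, Complex.conj_ofReal]
  rw [mul_assoc (Real.sqrt (1 - w ^ 2) : ℂ), ← e_add]
  congr 4
  ring

theorem conj_coeffC (ξ : ℝ) : conj (coeffC α β w θ φ ψ ξ) =
    (w : ℂ)⁻¹ * e (-φ) * e (-ξ) * e θ * e (β * ξ) *
      (e (-(α - 1) * ξ) - Real.sqrt (1 - w ^ 2) * e (-ψ)) := by
  rw [coeffC]
  simp only [map_mul, map_sub, map_one, map_inv₀, conj_e, Complex.conj_ofReal]
  have h1 : e (-(φ - θ)) = e (-φ) * e θ := by rw [← e_add]; congr 1; ring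
  have h2 : e (-(-(β - α) * ξ)) = e (-ξ) * e (β * ξ) * e (-(α - 1) * ξ) := by
    rw [← e_add, ← e_add]; congr 1; ring
  have h3 : e (-ψ) = e (-(α - 1) * ξ) * e (-(ψ - (α - 1) * ξ)) := by
    rw [← e_add]; congr 1; ring
  rw [h1, h2, h3]
  ring

end Coefficients

/-! ### The unitary operator -/

section Transform

variable {α β w θ φ ψ : ℝ}

/-- In the time domain: `L²(Ω)` is mapped onto `L²(ℝ) = L²(-∞, 0) ⊕ L²(0, ∞)`. The component
`(-∞, 0)` stays in place, while `(1, α)` and `(β, ∞)` are moved to `(0, α - 1)` and `(0, ∞)`, the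
coordinates in which the isometric right shift by `α - 1` on `L²(0, ∞)` decomposes that space. -/
theorem exists_timeDomain_isometryEquiv (hα : 1 < α) (hβ : α < β) (hw0 : 0 < w) (hw1 : w < 1) :
    ∃ U : L2Omega α β ≃ₗᵢ[ℂ] Lp ℂ 2 (volume : Measure ℝ), ∀ f, U f =
      cutoff measurableSet_Iio Iio_subset_Omega f +
        ((w : ℂ) • neumannInv (translate (-(α - 1))) (Real.sqrt (1 - w ^ 2) * e ψ)
            (e φ • translate 1 (cutoff measurableSet_Ioo Ioo_subset_Omega f)) +
          (translate (-(α - 1)) (neumannInv (translate (-(α - 1))) (Real.sqrt (1 - w ^ 2) * e ψ)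
              (e θ • translate β (cutoff measurableSet_Ioi Ioi_subset_Omega f))) -
            conj (Real.sqrt (1 - w ^ 2) * e ψ) •
              neumannInv (translate (-(α - 1))) (Real.sqrt (1 - w ^ 2) * e ψ)
                (e θ • translate β (cutoff measurableSet_Ioi Ioi_subset_Omega f)))) := by
  have hIci : (Iio (0 : ℝ))ᶜ = Ici 0 := compl_Iio
  have hTE : ∀ x ∈ supportedOn (Ici 0), translate (-(α - 1)) x ∈ supportedOn (Ici (α - 1)) :=
    fun x hx => translate_mem_supportedOn hx fun y hy => by
      simp only [mem_Ici] at hy ⊢; linarith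
  have hsub : supportedOn (Ici (α - 1)) ≤ supportedOn (Ici 0) := fun x hx => by
    rw [mem_supportedOn] at hx ⊢
    filter_upwards [hx] with y h1 h2
    exact h1 fun h3 => h2 (by simp only [mem_Ici] at h3 ⊢; linarith)
  -- the orthogonal complement of `T L²(0, ∞)` in `L²(0, ∞)` is `L²(0, α - 1)`
  have hK : ∀ k ∈ supportedOn (Ici 0), (∀ x ∈ supportedOn (Ici 0),
      ⟪translate (-(α - 1)) x, k⟫_ℂ = 0) → k ∈ supportedOn (Ioo 0 (α - 1)) := fun k hk hk' => by
    have h1 : k ∈ supportedOn (Ici (α - 1))ᶜ :=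
      mem_supportedOn_compl measurableSet_Ici fun g hg => by
        have h2 := hk' (translate (α - 1) g) (translate_mem_supportedOn hg fun y hy => by
          simp only [mem_Ici] at hy ⊢; linarith)
        have h3 := translate_translate_neg (-(α - 1)) g
        rw [neg_neg] at h3
        rwa [h3] at h2
    have h2 := mem_supportedOn_inter hk h1
    rwa [compl_Ici, Ici_inter_Iio, ← supportedOn_congr_ae Ioo_ae_eq_Ico] at h2
  have hS12 : Disjoint (Iio (0 : ℝ)) (Ioo 1 α) := by
    rw [Set.disjoint_left]; intro x h1 h2; simp only [mem_Iio, mem_Ioo] at h1 h2; linarith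
  have hS13 : Disjoint (Iio (0 : ℝ)) (Ioi β) := by
    rw [Set.disjoint_left]; intro x h1 h2; simp only [mem_Iio, mem_Ioi] at h1 h2; linarith
  have hS23 : Disjoint (Ioo 1 α) (Ioi β) := by
    rw [Set.disjoint_left]; intro x h1 h2; simp only [mem_Ioi, mem_Ioo] at h1 h2; linarith
  have inv : ∀ (c a : ℝ) (g : Lp ℂ 2 (volume : Measure ℝ)),
      e a • translate c (e (-a) • translate (-c) g) = g := fun c a g => by
    rw [map_smul, translate_translate_neg, smul_smul, ← e_add, add_neg_cancel, e_zero, one_smul]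
  refine exists_isometryEquiv_shift (N := supportedOn (Iio 0)) (E := supportedOn (Ici 0))
    (T := translate (-(α - 1))) (b := Real.sqrt (1 - w ^ 2) * e ψ) ?_ hw0.ne' ?_ ?_ ?_
    (fun x hx => hsub (hTE x hx))
    (cutoff measurableSet_Iio Iio_subset_Omega)
    (e φ • (translate 1).toLinearEquiv.toLinearMap ∘ₗ cutoff measurableSet_Ioo Ioo_subset_Omega)
    (e θ • (translate β).toLinearEquiv.toLinearMap ∘ₗ cutoff measurableSet_Ioi Ioi_subset_Omega)
    (fun f => cutoff_mem_supportedOn _ _ f) ?_ ?_ ?_ ?_ ?_ ?_ ?_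
  · rw [norm_sqrt_mul_e]; exact sqrt_one_sub_sq_lt_one hw0
  · rw [norm_sqrt_mul_e, Real.sq_sqrt (by nlinarith)]; ring
  · exact fun n hn x hx => inner_eq_zero_of_supportedOn hn hx
      (by rw [← hIci]; exact disjoint_compl_right)
  · intro x
    have := exists_supportedOn_add (measurableSet_Iio (a := (0 : ℝ))) x
    rwa [hIci] at this
  · exact fun f => Submodule.smul_mem _ _ (translate_mem_supportedOn (cutoff_mem_supportedOn _ _ f)
      fun x hx => by simp only [mem_Ioo, mem_Ici] at hx ⊢; linarith)
  · intro f y hy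
    refine inner_eq_zero_of_supportedOn (hTE y hy) (S' := Iio (α - 1)) ?_ ?_
    · exact Submodule.smul_mem _ _ (translate_mem_supportedOn (cutoff_mem_supportedOn _ _ f)
        fun x hx => by simp only [mem_Ioo, mem_Iio] at hx ⊢; linarith)
    · rw [← compl_Ici]; exact disjoint_compl_right
  · exact fun f => Submodule.smul_mem _ _ (translate_mem_supportedOn (cutoff_mem_supportedOn _ _ f)
      fun x hx => by simp only [mem_Ioi, mem_Ici] at hx ⊢; linarith)
  · intro f
    have h1 : ∀ (c a : ℝ) (g : Lp ℂ 2 (volume : Measure ℝ)), ‖e a • translate c g‖ = ‖g‖ :=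
      fun c a g => by rw [norm_smul, norm_e, one_mul, LinearIsometryEquiv.norm_map]
    change ‖f‖ ^ 2 = _ + (‖e φ • translate 1 _‖ ^ 2 + ‖e θ • translate β _‖ ^ 2)
    rw [h1, h1, norm_sq_cutoff, norm_sq_cutoff, norm_sq_cutoff, norm_sq_eq_integral]
    have h2 := setIntegral_Omega hα hβ (S := univ) (h := fun x => ‖f x‖ ^ 2) MeasurableSet.univ
      (by rw [inter_univ]; exact (Lp.memLp f).integrable_norm_pow (by norm_num))
    simpa only [inter_univ] using h2
  · intro n hn
    obtain ⟨u, hu, hu0⟩ := exists_cutoff_eq measurableSet_Iio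
      (Iio_subset_Omega (α := α) (β := β)) hn
    refine ⟨u, hu, ?_, ?_⟩
    · change e φ • translate 1 (cutoff _ _ u) = 0
      rw [hu0 _ _ _ hS12, map_zero, smul_zero]
    · change e θ • translate β (cutoff _ _ u) = 0
      rw [hu0 _ _ _ hS13, map_zero, smul_zero]
  · intro k hk hk'
    obtain ⟨u, hu, hu0⟩ := exists_cutoff_eq measurableSet_Ioo (Ioo_subset_Omega (α := α) (β := β))
      (f := e (-φ) • translate (-1) k) (Submodule.smul_mem _ _ (translate_mem_supportedOn
        (hK k hk hk') fun x hx => by simp only [mem_Ioo] at hx ⊢; constructor <;> linarith))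
    refine ⟨u, hu0 _ _ _ hS12.symm, ?_, ?_⟩
    · change e φ • translate 1 (cutoff _ _ u) = k
      rw [hu, inv]
    · change e θ • translate β (cutoff _ _ u) = 0
      rw [hu0 _ _ _ hS23, map_zero, smul_zero]
  · intro p hp
    rw [← supportedOn_congr_ae Ioi_ae_eq_Ici] at hp
    obtain ⟨u, hu, hu0⟩ := exists_cutoff_eq measurableSet_Ioi (Ioi_subset_Omega (α := α) (β := β))
      (f := e (-θ) • translate (-β) p) (Submodule.smul_mem _ _ (translate_mem_supportedOn
        hp fun x hx => by simp only [mem_Ioi] at hx ⊢; linarith))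
    refine ⟨u, hu0 _ _ _ hS13.symm, ?_, ?_⟩
    · change e φ • translate 1 (cutoff _ _ u) = 0
      rw [hu0 _ _ _ hS23.symm, map_zero, smul_zero]
    · change e θ • translate β (cutoff _ _ u) = p
      rw [hu, inv]

/-- The Fourier transform turns `(1 - b T)⁻¹`, `T` a translation, into division by
`1 - b e(cξ)`. -/
theorem fourier_neumannInv {c : ℝ} {b : ℂ} (hb : ‖b‖ < 1) (k : Lp ℂ 2 (volume : Measure ℝ)) :
    ∀ᵐ ξ, (1 - b * e (c * ξ)) *
        (𝓕 (neumannInv (translate c) b k) : Lp ℂ 2 (volume : Measure ℝ)) ξ =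
      (𝓕 k : Lp ℂ 2 (volume : Measure ℝ)) ξ := by
  have h := congrArg (Lp.fourierTransformₗᵢ ℝ ℂ) (neumannInv_sub (translate c) hb k)
  rw [map_sub, map_smul] at h
  filter_upwards [fourier_translate c (neumannInv (translate c) b k),
    Lp.coeFn_sub (Lp.fourierTransformₗᵢ ℝ ℂ (neumannInv (translate c) b k))
      (b • Lp.fourierTransformₗᵢ ℝ ℂ (translate c (neumannInv (translate c) b k))),
    Lp.coeFn_smul b (Lp.fourierTransformₗᵢ ℝ ℂ (translate c (neumannInv (translate c) b k)))]
    with ξ h1 h2 h3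
  change _ = Lp.fourierTransformₗᵢ ℝ ℂ k ξ
  rw [← h, h2, Pi.sub_apply, h3, Pi.smul_apply, smul_eq_mul]
  change _ = _ - b * (𝓕 (translate c (neumannInv (translate c) b k)) : Lp ℂ 2 _) ξ
  rw [h1, sub_mul, one_mul, mul_assoc]
  rfl

theorem fourier_smul_translate (c : ℝ) (a : ℂ) (g : Lp ℂ 2 (volume : Measure ℝ)) :
    (𝓕 (a • translate c g) : Lp ℂ 2 (volume : Measure ℝ)) =ᵐ[volume]
      fun ξ => a * (e (c * ξ) * (𝓕 g : Lp ℂ 2 (volume : Measure ℝ)) ξ) := by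
  have h := map_smul (Lp.fourierTransformₗᵢ ℝ ℂ) a (translate c g)
  filter_upwards [Lp.coeFn_smul a (Lp.fourierTransformₗᵢ ℝ ℂ (translate c g)),
    fourier_translate c g] with ξ h1 h2
  change Lp.fourierTransformₗᵢ ℝ ℂ (a • translate c g) ξ = _
  rw [h, h1, Pi.smul_apply, smul_eq_mul, ← h2]
  rfl

theorem fourier_cutoff {S D : Set ℝ} (hS : MeasurableSet S) (hSD : S ⊆ D)
    (f : Lp ℂ 2 (volume.restrict D)) (hf : IntegrableOn f D) :
    (𝓕 (cutoff hS hSD f) : Lp ℂ 2 (volume : Measure ℝ)) =ᵐ[volume]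
      fun ξ => ∫ x in S, e (-(ξ * x)) * f x := by
  have h1 : Integrable (cutoff hS hSD f) :=
    (integrable_congr (coeFn_cutoff hS hSD f)).2 ((integrable_indicator_iff hS).2 (hf.mono_set hSD))
  filter_upwards [fourier_ae_eq_integral _ h1] with ξ h2
  rw [h2, ← integral_indicator hS]
  refine integral_congr_ae ?_
  filter_upwards [coeFn_cutoff hS hSD f] with x hx
  rw [hx]
  by_cases h : x ∈ S <;> simp [h]

/-- On integrable functions, the operator `V` is given by the pairing with the generalized
eigenfunctions. -/
def IsPairing (θ : ℝ) (V : L2Omega α β ≃ₗᵢ[ℂ] Lp ℂ 2 (sigmaB α w φ ψ)) : Prop :=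
  ∀ f : L2Omega α β, IntegrableOn f (Omega α β) → V f =ᵐ[sigmaB α w φ ψ] fun ξ =>
    ∫ x in Omega α β, conj (genEigen α β w θ φ ψ ξ x) * f x

/-- The operator `V_B`: it is unitary, and on integrable functions it is given by the pairing
with the generalized eigenfunctions. -/
theorem exists_isometryEquiv_integral (hα : 1 < α) (hβ : α < β) (hw0 : 0 < w) (hw1 : w < 1) :
    ∃ V : L2Omega α β ≃ₗᵢ[ℂ] Lp ℂ 2 (sigmaB α w φ ψ), IsPairing θ V := by
  obtain ⟨U, hU⟩ := exists_timeDomain_isometryEquiv (θ := θ) (φ := φ) (ψ := ψ) hα hβ hw0 hw1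
  obtain ⟨M, hM⟩ := exists_isometryEquiv_mul (μ := volume)
    (m := fun ξ => conj (coeffA α w φ ψ ξ))
    (Complex.continuous_conj.comp continuous_coeffA).measurable
    (fun ξ => by simpa using coeffA_ne_zero hw0 ξ) (sigmaB_eq (α := α) (w := w) (φ := φ) (ψ := ψ))
  refine ⟨(U.trans (Lp.fourierTransformₗᵢ ℝ ℂ)).trans M, fun f hf => ?_⟩
  change M (Lp.fourierTransformₗᵢ ℝ ℂ (U f)) =ᵐ[_] _
  refine (hM _).trans ((absolutelyContinuous_weight sigmaB_eq).ae_le ?_)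
  have hb : ‖(Real.sqrt (1 - w ^ 2) : ℂ) * e ψ‖ < 1 := by
    rw [norm_sqrt_mul_e]; exact sqrt_one_sub_sq_lt_one hw0
  rw [hU]
  set f₁ := cutoff measurableSet_Iio Iio_subset_Omega f
  set f₂ := cutoff measurableSet_Ioo Ioo_subset_Omega f
  set f₃ := cutoff measurableSet_Ioi Ioi_subset_Omega f
  set b : ℂ := Real.sqrt (1 - w ^ 2) * e ψ with hbdef
  set u := neumannInv (translate (-(α - 1))) b (e φ • translate 1 f₂)
  set v := neumannInv (translate (-(α - 1))) b (e θ • translate β f₃)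
  set Φ := Lp.fourierTransformₗᵢ ℝ ℂ
  have lin : Φ (f₁ + ((w : ℂ) • u + (translate (-(α - 1)) v - conj b • v))) =ᵐ[volume]
      fun ξ => Φ f₁ ξ + (w * Φ u ξ + (Φ (translate (-(α - 1)) v) ξ - conj b * Φ v ξ)) := by
    rw [map_add, map_add, map_sub, map_smul, map_smul]
    filter_upwards [Lp.coeFn_add (Φ f₁) ((w : ℂ) • Φ u + (Φ (translate (-(α - 1)) v) -
        conj b • Φ v)), Lp.coeFn_add ((w : ℂ) • Φ u) (Φ (translate (-(α - 1)) v) - conj b • Φ v),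
      Lp.coeFn_sub (Φ (translate (-(α - 1)) v)) (conj b • Φ v), Lp.coeFn_smul (w : ℂ) (Φ u),
      Lp.coeFn_smul (conj b) (Φ v)] with ξ h1 h2 h3 h4 h5
    rw [h1, Pi.add_apply, h2, Pi.add_apply, h3, Pi.sub_apply, h4, h5]
    rfl
  filter_upwards [lin, fourier_neumannInv (c := -(α - 1)) hb (e φ • translate 1 f₂),
    fourier_neumannInv (c := -(α - 1)) hb (e θ • translate β f₃),
    fourier_smul_translate 1 (e φ) f₂, fourier_smul_translate β (e θ) f₃,
    fourier_translate (-(α - 1)) v,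
    fourier_cutoff measurableSet_Iio (Iio_subset_Omega (α := α) (β := β)) f hf,
    fourier_cutoff measurableSet_Ioo (Ioo_subset_Omega (α := α) (β := β)) f hf,
    fourier_cutoff measurableSet_Ioi (Ioi_subset_Omega (α := α) (β := β)) f hf]
    with ξ h0 hu hv h2 h3 hT g1 g2 g3
  have hint := setIntegral_conj_genEigen (θ := θ) (φ := φ) (ψ := ψ) hα hβ hw0 (S := univ)
    MeasurableSet.univ (by rwa [inter_univ]) ξ
  simp only [inter_univ] at hint
  rw [hint, h0, ← g1, ← g2, ← g3]
  rw [h2] at hu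
  rw [h3] at hv
  change (1 - b * e (-(α - 1) * ξ)) * Φ u ξ = e φ * (e (1 * ξ) * Φ f₂ ξ) at hu
  change (1 - b * e (-(α - 1) * ξ)) * Φ v ξ = e θ * (e (β * ξ) * Φ f₃ ξ) at hv
  change Φ (translate (-(α - 1)) v) ξ = e (-(α - 1) * ξ) * Φ v ξ at hT
  change _ = conj (coeffA α w φ ψ ξ) * Φ f₁ ξ + (Φ f₂ ξ + conj (coeffC α β w θ φ ψ ξ) * Φ f₃ ξ)
  have hcb : conj b = Real.sqrt (1 - w ^ 2) * e (-ψ) := by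
    rw [hbdef, map_mul, Complex.conj_ofReal, conj_e]
  have hw : (w : ℂ) ≠ 0 := by exact_mod_cast hw0.ne'
  rw [hT, conj_coeffA, conj_coeffC, ← hcb, ← hbdef]
  rw [one_mul] at hu
  have k1 : e (-φ) * e φ = 1 := by rw [← e_add, neg_add_cancel, e_zero]
  have k2 : e (-ξ) * e ξ = 1 := by rw [← e_add, neg_add_cancel, e_zero]
  generalize e (-(α - 1) * ξ) = z at *
  have r1 : (w : ℂ)⁻¹ * e (-φ) * e (-ξ) * (1 - b * z) * (w * Φ u ξ) = Φ f₂ ξ := by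
    calc _ = ((w : ℂ)⁻¹ * w) * (e (-φ) * e (-ξ)) * ((1 - b * z) * Φ u ξ) := by ring
      _ = (e (-φ) * e φ) * (e (-ξ) * e ξ) * Φ f₂ ξ := by
        rw [inv_mul_cancel₀ hw, hu]; ring
      _ = Φ f₂ ξ := by rw [k1, k2]; ring
  linear_combination r1 + (w : ℂ)⁻¹ * e (-φ) * e (-ξ) * (z - conj b) * hv

end Transform

/-! ### Convergence in the mean -/

section Truncation

variable {μ : Measure ℝ}

/-- The truncation `χ_{[-R, R]} f` of `f ∈ L²(μ)`. -/
noncomputable def truncLp (R : ℝ) (f : Lp ℂ 2 μ) : Lp ℂ 2 μ :=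
  ((Lp.memLp f).indicator (measurableSet_Icc (a := -R) (b := R))).toLp _

theorem coeFn_truncLp (R : ℝ) (f : Lp ℂ 2 μ) :
    truncLp R f =ᵐ[μ] (Icc (-R) R).indicator f :=
  MemLp.coeFn_toLp _

theorem eLpNorm_sub_eq_enorm {f g : Lp ℂ 2 μ} {u : ℝ → ℂ} (hu : u =ᵐ[μ] g) :
    eLpNorm (fun y => f y - u y) 2 μ = ‖f - g‖ₑ := by
  rw [Lp.enorm_def]
  refine eLpNorm_congr_ae ?_
  filter_upwards [Lp.coeFn_sub f g, hu] with x h1 h2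
  rw [h1, Pi.sub_apply, h2]

theorem tendsto_truncLp (f : Lp ℂ 2 μ) : Tendsto (fun R => truncLp R f) atTop (𝓝 f) := by
  have hfin : ∫⁻ x, ‖f x‖ₑ ^ (2 : ℝ) ∂μ ≠ ∞ := by
    simpa using (lintegral_rpow_enorm_lt_top_of_eLpNorm_lt_top (by norm_num) (by norm_num)
      (Lp.memLp f).2).ne
  have h1 : Tendsto (fun R : ℝ => ∫⁻ x, ‖(Icc (-R) R)ᶜ.indicator f x‖ₑ ^ (2 : ℝ) ∂μ) atTop
      (𝓝 (∫⁻ _, 0 ∂μ)) := by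
    refine tendsto_lintegral_filter_of_dominated_convergence' (fun x => ‖f x‖ₑ ^ (2 : ℝ))
      (Eventually.of_forall fun R => ?_) (Eventually.of_forall fun R => ae_of_all _ fun x => ?_)
      hfin (ae_of_all _ fun x => ?_)
    · exact (((Lp.aestronglyMeasurable f).indicator measurableSet_Icc.compl).enorm).pow_const _
    · gcongr
      exact enorm_indicator_le_enorm_self _ _
    · refine tendsto_const_nhds.congr' ?_
      filter_upwards [eventually_ge_atTop |x|] with R hR
      have hx : x ∉ (Icc (-R) R)ᶜ := fun h => h (abs_le.1 hR)
      simp [indicator_of_notMem hx]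
  rw [lintegral_zero] at h1
  have h2 := h1.ennrpow_const (1 / 2 : ℝ)
  rw [ENNReal.zero_rpow_of_pos (by norm_num)] at h2
  rw [tendsto_iff_edist_tendsto_0]
  refine h2.congr fun R => ?_
  rw [edist_comm, edist_eq_enorm_sub, ← eLpNorm_sub_eq_enorm (coeFn_truncLp R f).symm,
    eLpNorm_eq_lintegral_rpow_enorm_toReal (by norm_num) (by norm_num)]
  simp only [ENNReal.toReal_ofNat]
  congr 1
  refine lintegral_congr fun x => ?_
  by_cases h : x ∈ Icc (-R) R <;> simp [h]

theorem L2Limit_of_tendsto {u : ℝ → ℝ → ℂ} {f : Lp ℂ 2 μ} {G : ℝ → Lp ℂ 2 μ}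
    (hu : ∀ R, u R =ᵐ[μ] G R) (hG : Tendsto G atTop (𝓝 f)) : L2Limit μ u f := by
  rw [tendsto_iff_edist_tendsto_0] at hG
  refine hG.congr fun R => ?_
  rw [eLpNorm_sub_eq_enorm (hu R), edist_comm, edist_eq_enorm_sub]

end Truncation

/-! ### Eigenfunction transform and expansion -/

section Expansion

variable {α β w θ φ ψ : ℝ}

theorem isLocallyFiniteMeasure_sigmaB (hw0 : 0 < w) :
    IsLocallyFiniteMeasure (sigmaB α w φ ψ) := by
  unfold sigmaB mB
  refine IsLocallyFiniteMeasure.withDensity_ofReal ?_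
  refine Continuous.inv₀ (continuous_coeffA.norm.pow 2) fun ξ => ?_
  have := norm_pos_iff.2 (coeffA_ne_zero (α := α) (φ := φ) (ψ := ψ) hw0 ξ)
  positivity

theorem integrableOn_Icc_of_Lp {μ : Measure ℝ} [IsLocallyFiniteMeasure μ] (f : Lp ℂ 2 μ)
    (a b : ℝ) : IntegrableOn f (Icc a b) μ := by
  have : IsFiniteMeasure (μ.restrict (Icc a b)) :=
    ⟨by rw [Measure.restrict_apply_univ]; exact isCompact_Icc.measure_lt_top⟩
  exact ((Lp.memLp f).restrict (Icc a b)).integrable (by norm_num)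

variable {V : L2Omega α β ≃ₗᵢ[ℂ] Lp ℂ 2 (sigmaB α w φ ψ)}

theorem transform_truncLp (hV : IsPairing θ V) (R : ℝ) (f : L2Omega α β) :
    (fun ξ => ∫ x in Omega α β ∩ Icc (-R) R, conj (genEigen α β w θ φ ψ ξ x) * f x)
      =ᵐ[sigmaB α w φ ψ] V (truncLp R f) := by
  have hint : IntegrableOn (truncLp R f) (Omega α β) := by
    refine (integrable_congr (coeFn_truncLp R f)).2 ((integrable_indicator_iff measurableSet_Icc).2
      (integrableOn_Icc_of_Lp f _ _))
  refine EventuallyEq.trans (Eventually.of_forall fun ξ => ?_) (hV _ hint).symm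
  simp only
  rw [← setIntegral_indicator measurableSet_Icc]
  refine integral_congr_ae ?_
  filter_upwards [coeFn_truncLp R f] with x hx
  rw [hx]
  by_cases h : x ∈ Icc (-R) R <;> simp [h]

theorem isTransform (hV : IsPairing θ V) (f : L2Omega α β) : IsTransform α β w θ φ ψ f (V f) :=
  L2Limit_of_tendsto (transform_truncLp hV · f)
    ((V.continuous.tendsto f).comp (tendsto_truncLp f))

/-- The adjoint of `V` on truncated functions, by Fubini's theorem against indicator functions. -/
theorem expansion_truncLp (hV : IsPairing θ V) (hw0 : 0 < w) (R : ℝ) (g : Lp ℂ 2 (sigmaB α w φ ψ)) :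
    (fun x => ∫ ξ in Icc (-R) R, g ξ * genEigen α β w θ φ ψ ξ x ∂(sigmaB α w φ ψ))
      =ᵐ[volume.restrict (Omega α β)] V.symm (truncLp R g) := by
  have := isLocallyFiniteMeasure_sigmaB (α := α) (φ := φ) (ψ := ψ) hw0
  have : IsFiniteMeasure ((sigmaB α w φ ψ).restrict (Icc (-R) R)) :=
    ⟨by rw [Measure.restrict_apply_univ]; exact isCompact_Icc.measure_lt_top⟩
  have hg : IntegrableOn g (Icc (-R) R) (sigmaB α w φ ψ) := integrableOn_Icc_of_Lp g _ _
  have hprod : ∀ s, volume.restrict (Omega α β) s < ∞ → Integrable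
      (fun p : ℝ × ℝ => g p.2 * genEigen α β w θ φ ψ p.2 p.1)
      (((volume.restrict (Omega α β)).restrict s).prod
        ((sigmaB α w φ ψ).restrict (Icc (-R) R))) := fun s hs => by
    have : IsFiniteMeasure ((volume.restrict (Omega α β)).restrict s) :=
      ⟨by rwa [Measure.restrict_apply_univ]⟩
    exact (hg.integrable.comp_snd ((volume.restrict (Omega α β)).restrict s)).mul_bdd
      (c := w⁻¹ * 2 + 1 + w⁻¹ * 2)
      (measurable_genEigen.comp measurable_swap).aestronglyMeasurable
      (ae_of_all _ fun p => norm_genEigen_le hw0 _ _)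
  refine ae_eq_of_forall_setIntegral_eq_of_sigmaFinite (fun s _ hμs => ?_) (fun s _ hμs => ?_)
    fun s hs hμs => ?_
  · exact (hprod s hμs).integral_prod_left
  · have : IsFiniteMeasure ((volume.restrict (Omega α β)).restrict s) :=
      ⟨by rwa [Measure.restrict_apply_univ]⟩
    exact ((Lp.memLp (V.symm (truncLp R g))).restrict s).integrable (by norm_num)
  · rw [integral_integral_swap (hprod s hμs),
      ← L2.inner_indicatorConstLp_one (𝕜 := ℂ) hs hμs.ne, ← V.inner_map_map, V.apply_symm_apply,
      L2.inner_def, ← integral_indicator measurableSet_Icc]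
    have h1 : IntegrableOn (indicatorConstLp 2 hs hμs.ne (1 : ℂ)) (Omega α β) :=
      (integrable_congr indicatorConstLp_coeFn).2 ((integrable_indicator_iff hs).2
        (integrableOn_const hμs.ne))
    refine integral_congr_ae ?_
    filter_upwards [hV _ h1, coeFn_truncLp R g] with ξ h2 h3
    rw [h2, h3]
    by_cases h : ξ ∈ Icc (-R) R
    · rw [indicator_of_mem h, indicator_of_mem h, RCLike.inner_apply, ← integral_conj,
        ← integral_const_mul, ← integral_indicator hs]
      refine integral_congr_ae ?_
      filter_upwards [indicatorConstLp_coeFn (p := 2) (hs := hs) (hμs := hμs.ne) (c := (1 : ℂ))]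
        with x hx
      rw [hx]
      by_cases hxs : x ∈ s <;> simp [hxs]
    · simp [h]

theorem isExpansion (hV : IsPairing θ V) (hw0 : 0 < w) (f : L2Omega α β) :
    IsExpansion α β w θ φ ψ (V f) f := by
  refine L2Limit_of_tendsto (expansion_truncLp hV hw0 · (V f)) ?_
  have h := (V.symm.continuous.tendsto (V f)).comp (tendsto_truncLp (V f))
  rwa [V.symm_apply_apply] at h

theorem parseval (V : L2Omega α β ≃ₗᵢ[ℂ] Lp ℂ 2 (sigmaB α w φ ψ)) (f : L2Omega α β) :
    ∫ x in Omega α β, ‖f x‖ ^ 2 = ∫ ξ, ‖V f ξ‖ ^ 2 ∂(sigmaB α w φ ψ) := by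
  rw [← norm_sq_eq_integral, ← norm_sq_eq_integral, V.norm_map]

end Expansion

/-! ### Integration by parts for absolutely continuous functions -/

section ByParts

variable {F : ℝ → ℂ} {a b : ℝ}

theorem absolutelyContinuousOnInterval_of_dist_le {g : ℝ → ℝ}
    (hF : AbsolutelyContinuousOnInterval F a b) (h : ∀ x y, dist (g x) (g y) ≤ dist (F x) (F y)) :
    AbsolutelyContinuousOnInterval g a b :=
  squeeze_zero (fun _ => Finset.sum_nonneg fun _ _ => dist_nonneg)
    (fun _ => Finset.sum_le_sum fun _ _ => h _ _) hF

theorem ae_differentiableAt_of_absolutelyContinuous (hF : AbsolutelyContinuousOnInterval F a b) :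
    ∀ᵐ x, x ∈ uIcc a b → DifferentiableAt ℝ F x :=
  hF.boundedVariationOn.ae_differentiableAt_of_mem_uIcc

/-- The fundamental theorem of calculus for absolutely continuous complex valued functions. -/
theorem intervalIntegral_deriv_of_absolutelyContinuous
    (hF : AbsolutelyContinuousOnInterval F a b) :
    IntervalIntegrable (deriv F) volume a b ∧ ∫ x in a..b, deriv F x = F b - F a := by
  have hre : AbsolutelyContinuousOnInterval (fun x => (F x).re) a b :=
    absolutelyContinuousOnInterval_of_dist_le hF fun x y => by
      rw [Real.dist_eq, ← Complex.sub_re, dist_eq_norm]; exact Complex.abs_re_le_norm _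
  have him : AbsolutelyContinuousOnInterval (fun x => (F x).im) a b :=
    absolutelyContinuousOnInterval_of_dist_le hF fun x y => by
      rw [Real.dist_eq, ← Complex.sub_im, dist_eq_norm]; exact Complex.abs_im_le_norm _
  have ofReal : ∀ {g : ℝ → ℝ}, IntervalIntegrable g volume a b →
      IntervalIntegrable (fun x => (g x : ℂ)) volume a b := fun h => ⟨h.1.ofReal, h.2.ofReal⟩
  have hr := ofReal hre.intervalIntegrable_deriv
  have hi := (ofReal him.intervalIntegrable_deriv).mul_const Complex.I
  have heq : ∀ᵐ x, x ∈ uIoc a b → deriv F x =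
      ((deriv (fun x => (F x).re) x : ℝ) : ℂ) +
        ((deriv (fun x => (F x).im) x : ℝ) : ℂ) * Complex.I := by
    filter_upwards [ae_differentiableAt_of_absolutelyContinuous hF] with x hx hxab
    have hd := (hx (uIoc_subset_uIcc hxab)).hasDerivAt
    have h1 : HasDerivAt (fun x => (F x).re) (deriv F x).re x :=
      Complex.reCLM.hasFDerivAt.comp_hasDerivAt x hd
    have h2 : HasDerivAt (fun x => (F x).im) (deriv F x).im x :=
      Complex.imCLM.hasFDerivAt.comp_hasDerivAt x hd
    rw [h1.deriv, h2.deriv, Complex.re_add_im]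
  refine ⟨(hr.add hi).congr_ae ?_, ?_⟩
  · rw [EventuallyEq, ae_restrict_iff' measurableSet_uIoc]
    filter_upwards [heq] with x hx hxab using (hx hxab).symm
  · rw [intervalIntegral.integral_congr_ae heq, intervalIntegral.integral_add hr hi,
      intervalIntegral.integral_mul_const, intervalIntegral.integral_ofReal,
      intervalIntegral.integral_ofReal, hre.integral_deriv_eq_sub, him.integral_deriv_eq_sub]
    apply Complex.ext <;> simp

theorem hasDerivAt_e_neg_mul (ξ x : ℝ) : HasDerivAt (fun x : ℝ => e (-(ξ * x)))
    (-(2 * Real.pi * Complex.I * ξ) * e (-(ξ * x))) x := by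
  have h0 : HasDerivAt (fun x : ℝ => -(ξ * x)) (-ξ) x := by
    simpa using ((hasDerivAt_id x).const_mul ξ).fun_neg
  refine ((h0.ofReal_comp.const_mul (2 * Real.pi * Complex.I : ℂ)).cexp).congr_deriv ?_
  rw [e]
  push_cast
  ring

theorem integral_e_mul_deriv (hF : AbsolutelyContinuousOnInterval F a b) (ξ : ℝ) :
    ∫ x in a..b, e (-(ξ * x)) * deriv F x = e (-(ξ * b)) * F b - e (-(ξ * a)) * F a +
      2 * Real.pi * Complex.I * ξ * ∫ x in a..b, e (-(ξ * x)) * F x := by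
  have hcont : Continuous fun x : ℝ => e (-(ξ * x)) :=
    continuous_e.comp (continuous_const.mul continuous_id).neg
  have he : AbsolutelyContinuousOnInterval (fun x : ℝ => e (-(ξ * x))) a b := by
    refine ContDiffOn.absolutelyContinuousOnInterval (ContDiff.contDiffOn ?_)
    exact (contDiff_const.mul (Complex.ofRealCLM.contDiff.comp
      (contDiff_const.mul contDiff_id).neg)).cexp
  have hG : AbsolutelyContinuousOnInterval (fun x => e (-(ξ * x)) * F x) a b := he.smul hF
  have h1 := (intervalIntegral_deriv_of_absolutelyContinuous hG).2
  have hi1 : IntervalIntegrable (fun x => e (-(ξ * x)) * deriv F x) volume a b :=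
    (intervalIntegral_deriv_of_absolutelyContinuous hF).1.continuousOn_mul hcont.continuousOn
  have hi2 : IntervalIntegrable (fun x => -(2 * Real.pi * Complex.I * ξ) * (e (-(ξ * x)) * F x))
      volume a b :=
    (hG.continuousOn.intervalIntegrable).const_mul _
  have heq : ∀ᵐ x, x ∈ uIoc a b → deriv (fun x => e (-(ξ * x)) * F x) x =
      -(2 * Real.pi * Complex.I * ξ) * (e (-(ξ * x)) * F x) + e (-(ξ * x)) * deriv F x := by
    filter_upwards [ae_differentiableAt_of_absolutelyContinuous hF] with x hx hxab
    have hd := (hasDerivAt_e_neg_mul ξ x).mul (hx (uIoc_subset_uIcc hxab)).hasDerivAt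
    refine hd.deriv.trans ?_
    ring
  rw [intervalIntegral.integral_congr_ae heq, intervalIntegral.integral_add hi2 hi1,
    intervalIntegral.integral_const_mul] at h1
  linear_combination h1

end ByParts

/-! ### Diagonalization of the momentum operator -/

section Momentum

variable {α β w θ φ ψ : ℝ} {f : L2Omega α β} {F : ℝ → ℂ}

/-- The contributions of the finite endpoints `0, 1, α, β` to the integration by parts cancel
under the boundary condition. -/
theorem boundary_terms_cancel (hw0 : 0 < w) (hw1 : w < 1)
    (hF : paramMatrix w θ φ ψ *ᵥ ![F 1, F β] = ![F 0, F α]) (ξ : ℝ) :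
    conj (coeffA α w φ ψ ξ) * F 0 + (e (-(ξ * α)) * F α - e (-(ξ * 1)) * F 1) -
      conj (coeffC α β w θ φ ψ ξ) * (e (-(ξ * β)) * F β) = 0 := by
  have h0 := congrFun hF 0
  have h1 := congrFun hF 1
  simp only [paramMatrix, Matrix.mulVec, dotProduct, Fin.sum_univ_two, Matrix.of_apply,
    Matrix.cons_val_zero, Matrix.cons_val_one] at h0 h1
  have hw : (w : ℂ) ≠ 0 := by exact_mod_cast hw0.ne'
  have hs : (Real.sqrt (1 - w ^ 2) : ℂ) ^ 2 = 1 - (w : ℂ) ^ 2 := by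
    rw [← Complex.ofReal_pow, Real.sq_sqrt (by nlinarith)]; push_cast; ring
  rw [← h0, ← h1, conj_coeffA, conj_coeffC]
  have e1 : e (θ - ψ) = e θ * e (-ψ) := by rw [← e_add]; congr 1
  have e2 : e (θ - φ) = e θ * e (-φ) := by rw [← e_add]; congr 1
  have e3 : e (-(ξ * α)) = e (-ξ) * e (-(α - 1) * ξ) := by rw [← e_add]; congr 1; ring
  have e4 : e (-(ξ * 1)) = e (-ξ) := by rw [mul_one]
  have e5 : e (-(ξ * β)) = (e (β * ξ))⁻¹ := by rw [← e_neg]; congr 1; ring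
  have e6 : e (-φ) = (e φ)⁻¹ := e_neg φ
  have e7 : e (-ψ) = (e ψ)⁻¹ := e_neg ψ
  rw [e1, e2, e3, e4, e5, e6, e7]
  have n1 := e_ne_zero (β * ξ)
  have n2 := e_ne_zero φ
  have n3 := e_ne_zero ψ
  generalize e (-(α - 1) * ξ) = z
  generalize e (β * ξ) = y at *
  generalize (Real.sqrt (1 - w ^ 2) : ℂ) = s at *
  field_simp
  linear_combination (e (-ξ) * e θ * z * F β * e ψ) * hs

theorem setIntegral_Iio_inter_Icc (h : ℝ → ℂ) {R : ℝ} (hR : 0 < R) :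
    ∫ x in Iio 0 ∩ Icc (-R) R, h x = ∫ x in -R..0, h x := by
  have h1 : Iio 0 ∩ Icc (-R) R = Ico (-R) 0 := by
    ext x
    simp only [mem_inter_iff, mem_Iio, mem_Icc, mem_Ico]
    constructor
    · rintro ⟨a, b, c⟩; exact ⟨b, a⟩
    · rintro ⟨a, b⟩; exact ⟨b, a, by linarith⟩
  rw [h1, integral_Ico_eq_integral_Ioo, ← integral_Ioc_eq_integral_Ioo,
    intervalIntegral.integral_of_le (by linarith)]

theorem setIntegral_Ioo_inter_Icc (hα : 1 < α) (h : ℝ → ℂ) {R : ℝ} (hR : α ≤ R) :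
    ∫ x in Ioo 1 α ∩ Icc (-R) R, h x = ∫ x in 1..α, h x := by
  have h1 : Ioo 1 α ∩ Icc (-R) R = Ioo 1 α := by
    refine inter_eq_left.2 fun x hx => ?_
    constructor <;> linarith [hx.1, hx.2]
  rw [h1, ← integral_Ioc_eq_integral_Ioo, intervalIntegral.integral_of_le hα.le]

theorem setIntegral_Ioi_inter_Icc (hβ : 0 < β) (h : ℝ → ℂ) {R : ℝ} (hR : β ≤ R) :
    ∫ x in Ioi β ∩ Icc (-R) R, h x = ∫ x in β..R, h x := by
  have h1 : Ioi β ∩ Icc (-R) R = Ioc β R := by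
    ext x
    simp only [mem_inter_iff, mem_Ioi, mem_Icc, mem_Ioc]
    constructor
    · rintro ⟨a, b, c⟩; exact ⟨a, c⟩
    · rintro ⟨a, b⟩; exact ⟨a, by linarith, b⟩
  rw [h1, intervalIntegral.integral_of_le hR]

theorem uIcc_subset_closure_Omega_of_nonpos {a : ℝ} (ha : a ≤ 0) :
    uIcc a 0 ⊆ closure (Omega α β) := by
  rw [uIcc_of_le ha]
  refine Subset.trans ?_ (closure_mono Iio_subset_Omega)
  rw [closure_Iio]
  exact Icc_subset_Iic_self

theorem uIcc_subset_closure_Omega (hα : 1 < α) : uIcc 1 α ⊆ closure (Omega α β) := by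
  rw [uIcc_of_le hα.le, ← closure_Ioo hα.ne]
  exact closure_mono Ioo_subset_Omega

theorem uIcc_subset_closure_Omega_of_le {b : ℝ} (hb : β ≤ b) :
    uIcc β b ⊆ closure (Omega α β) := by
  rw [uIcc_of_le hb]
  refine Subset.trans ?_ (closure_mono Ioi_subset_Omega)
  rw [closure_Ioi]
  exact Icc_subset_Ici_self

/-- Integration by parts against `ψ_ξ` on `Ω ∩ [-R, R]`: only boundary terms at `±R` remain. -/
theorem setIntegral_genEigen_mul_deriv (hα : 1 < α) (hβ : α < β) (hw0 : 0 < w) (hw1 : w < 1)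
    (hF : IsRegularRep α β (paramMatrix w θ φ ψ) f F) {R : ℝ} (hR : β < R) (ξ : ℝ) :
    ∫ x in Omega α β ∩ Icc (-R) R, conj (genEigen α β w θ φ ψ ξ x) * deriv F x =
      conj (coeffC α β w θ φ ψ ξ) * (e (-(ξ * R)) * F R) -
        conj (coeffA α w φ ψ ξ) * (e (ξ * R) * F (-R)) +
      2 * Real.pi * Complex.I * ξ *
        ∫ x in Omega α β ∩ Icc (-R) R, conj (genEigen α β w θ φ ψ ξ x) * F x := by
  have hfin : IsFiniteMeasure ((volume.restrict (Omega α β)).restrict (Icc (-R) R)) :=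
    ⟨by rw [Measure.restrict_apply_univ]; exact isCompact_Icc.measure_lt_top⟩
  have hm : ∀ G : ℝ → ℂ, MemLp G 2 (volume.restrict (Omega α β)) →
      IntegrableOn G (Omega α β ∩ Icc (-R) R) := fun G hG => by
    have h := (hG.restrict (Icc (-R) R)).integrable (by norm_num)
    rwa [Measure.restrict_restrict measurableSet_Icc, inter_comm] at h
  have hFm : MemLp F 2 (volume.restrict (Omega α β)) :=
    (memLp_congr_ae hF.ae_eq).1 (Lp.memLp f)
  rw [setIntegral_conj_genEigen hα hβ hw0 measurableSet_Icc (hm _ hF.memLp_deriv),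
    setIntegral_conj_genEigen hα hβ hw0 measurableSet_Icc (hm _ hFm)]
  simp only [setIntegral_Iio_inter_Icc _ (show 0 < R by linarith),
    setIntegral_Ioo_inter_Icc hα _ (show α ≤ R by linarith),
    setIntegral_Ioi_inter_Icc (show 0 < β by linarith) _ hR.le]
  rw [integral_e_mul_deriv (hF.absCont _ _ (uIcc_subset_closure_Omega_of_nonpos (by linarith))),
    integral_e_mul_deriv (hF.absCont _ _ (uIcc_subset_closure_Omega hα)),
    integral_e_mul_deriv (hF.absCont _ _ (uIcc_subset_closure_Omega_of_le hR.le))]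
  have hb := boundary_terms_cancel (α := α) (β := β) hw0 hw1 hF.boundary ξ
  have z1 : e (-(ξ * 0)) = 1 := by rw [mul_zero, neg_zero, e_zero]
  have z2 : e (-(ξ * -R)) = e (ξ * R) := by congr 1; ring
  rw [z1, z2]
  linear_combination hb

/-- A square integrable function is small at `±R` for suitable large `R`. -/
theorem exists_norm_lt_of_memLp (hF : MemLp F 2 (volume.restrict (Omega α β))) {ε : ℝ}
    (hε : 0 < ε) (M : ℝ) : ∃ R, M < R ∧ ‖F R‖ < ε ∧ ‖F (-R)‖ < ε := by
  by_contra! hcon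
  have hsq : IntegrableOn (fun x => ‖F x‖ ^ 2) (Omega α β) :=
    hF.integrable_norm_pow (by norm_num)
  set M' := max M (max β 0)
  have h1 : IntegrableOn (fun x => ‖F x‖ ^ 2) (Ioi M') :=
    hsq.mono_set fun x hx => Ioi_subset_Omega <| show β < x from
      lt_of_le_of_lt ((le_max_left _ _).trans (le_max_right _ _)) hx
  have h2 : IntegrableOn (fun x => ‖F (-x)‖ ^ 2) (Ioi M') := by
    have h3 : IntegrableOn (fun x => ‖F x‖ ^ 2) (Iio (-M')) :=
      hsq.mono_set fun x hx => Iio_subset_Omega (by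
        have : (0 : ℝ) ≤ M' := (le_max_right _ _).trans (le_max_right _ _)
        simp only [mem_Iio] at hx ⊢
        linarith)
    have h4 := (Measure.measurePreserving_neg (volume : Measure ℝ)).integrableOn_comp_preimage
      (Homeomorph.neg ℝ).measurableEmbedding (f := fun x => ‖F x‖ ^ 2) (s := Iio (-M'))
    have h5 := h4.2 h3
    have h6 : (Neg.neg ⁻¹' Iio (-M') : Set ℝ) = Ioi M' := by ext x; simp
    rw [h6] at h5
    exact h5
  have h3 : IntegrableOn (fun _ : ℝ => ε ^ 2) (Ioi M') := by
    refine (h1.add h2).mono' aestronglyMeasurable_const ?_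
    rw [ae_restrict_iff' measurableSet_Ioi]
    refine ae_of_all _ fun x hx => ?_
    rw [Real.norm_of_nonneg (by positivity), Pi.add_apply]
    by_cases hx1 : ‖F x‖ < ε
    · have := hcon x (lt_of_le_of_lt (le_max_left _ _) hx) hx1
      have : ε ^ 2 ≤ ‖F (-x)‖ ^ 2 := by gcongr
      have : 0 ≤ ‖F x‖ ^ 2 := by positivity
      linarith
    · have : ε ^ 2 ≤ ‖F x‖ ^ 2 := by gcongr; exact not_lt.1 hx1
      have : 0 ≤ ‖F (-x)‖ ^ 2 := by positivity
      linarith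
  rw [integrableOn_const_iff] at h3
  rcases h3 with h3 | h3
  · exact hε.ne' (by simpa using h3)
  · simp at h3

theorem exists_seq_tendsto_zero_of_memLp (hF : MemLp F 2 (volume.restrict (Omega α β))) (M : ℝ) :
    ∃ r : ℕ → ℝ, Tendsto r atTop atTop ∧ (∀ n, M < r n) ∧
      Tendsto (fun n => F (r n)) atTop (𝓝 0) ∧ Tendsto (fun n => F (-r n)) atTop (𝓝 0) := by
  choose r hr h1 h2 using fun n : ℕ =>
    exists_norm_lt_of_memLp hF (Nat.one_div_pos_of_nat (α := ℝ) (n := n)) (max M n)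
  refine ⟨r, ?_, fun n => lt_of_le_of_lt (le_max_left _ _) (hr n), ?_, ?_⟩
  · exact tendsto_atTop_mono (fun n => (le_max_right M (n : ℝ)).trans (hr n).le)
      tendsto_natCast_atTop_atTop
  · exact squeeze_zero_norm (fun n => (h1 n).le) tendsto_one_div_add_atTop_nhds_zero_nat
  · exact squeeze_zero_norm (fun n => (h2 n).le) tendsto_one_div_add_atTop_nhds_zero_nat

/-- Convergence in the mean gives almost everywhere convergence along a subsequence. -/
theorem exists_subseq_transform {V : L2Omega α β ≃ₗᵢ[ℂ] Lp ℂ 2 (sigmaB α w φ ψ)}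
    (hV : IsPairing θ V) (g : L2Omega α β) {r : ℕ → ℝ} (hr : Tendsto r atTop atTop) :
    ∃ n : ℕ → ℕ, StrictMono n ∧ ∀ᵐ ξ ∂(sigmaB α w φ ψ), Tendsto (fun i =>
      ∫ x in Omega α β ∩ Icc (-r (n i)) (r (n i)), conj (genEigen α β w θ φ ψ ξ x) * g x)
      atTop (𝓝 (V g ξ)) := by
  obtain ⟨n, hn, h⟩ := (tendstoInMeasure_of_tendsto_Lp
    (((V.continuous.tendsto g).comp (tendsto_truncLp g)).comp hr)).exists_seq_tendsto_ae
  refine ⟨n, hn, ?_⟩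
  filter_upwards [h, ae_all_iff.2 fun i => transform_truncLp hV (r (n i)) g] with ξ h1 h2
  exact h1.congr fun i => (h2 i).symm

/-- The unitary operator `V` turns `P_B` into multiplication by the spectral variable. -/
theorem transform_momentum (hα : 1 < α) (hβ : α < β) (hw0 : 0 < w) (hw1 : w < 1)
    {V : L2Omega α β ≃ₗᵢ[ℂ] Lp ℂ 2 (sigmaB α w φ ψ)} (hV : IsPairing θ V)
    (f : (momentum α β (paramMatrix w θ φ ψ)).domain) :
    V (momentum α β (paramMatrix w θ φ ψ) f) =ᵐ[sigmaB α w φ ψ] fun ξ => (ξ : ℂ) * V f ξ := by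
  obtain ⟨F, hF⟩ := f.2
  have hP := momentum_apply_ae f hF
  set Pf := momentum α β (paramMatrix w θ φ ψ) f
  have hFm : MemLp F 2 (volume.restrict (Omega α β)) := (memLp_congr_ae hF.ae_eq).1 (Lp.memLp _)
  obtain ⟨r, hr, hrβ, hz1, hz2⟩ := exists_seq_tendsto_zero_of_memLp hFm β
  obtain ⟨n, hn, h1⟩ := exists_subseq_transform hV (f : L2Omega α β) hr
  -- a common subsequence for `f` and `P_B f`
  obtain ⟨m, hm, h2⟩ := exists_subseq_transform hV Pf (hr.comp hn.tendsto_atTop)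
  filter_upwards [h1, h2] with ξ h1 h2
  refine tendsto_nhds_unique h2 ?_
  set ρ : ℕ → ℝ := fun i => r (n (m i))
  have hρ : Tendsto (fun i => n (m i)) atTop atTop := hn.tendsto_atTop.comp hm.tendsto_atTop
  have sub : ∀ R, (volume.restrict (Omega α β ∩ Icc (-R) R)) ≤ volume.restrict (Omega α β) :=
    fun R => Measure.restrict_mono inter_subset_left le_rfl
  have key : ∀ i, ∫ x in Omega α β ∩ Icc (-ρ i) (ρ i), conj (genEigen α β w θ φ ψ ξ x) * Pf x =
      (2 * Real.pi * Complex.I : ℂ)⁻¹ * (conj (coeffC α β w θ φ ψ ξ) * (e (-(ξ * ρ i)) * F (ρ i)) -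
        conj (coeffA α w φ ψ ξ) * (e (ξ * ρ i) * F (-ρ i))) +
      ξ * ∫ x in Omega α β ∩ Icc (-ρ i) (ρ i), conj (genEigen α β w θ φ ψ ξ x) *
        (f : L2Omega α β) x := fun i => by
    have k1 : ∫ x in Omega α β ∩ Icc (-ρ i) (ρ i), conj (genEigen α β w θ φ ψ ξ x) * Pf x =
        (2 * Real.pi * Complex.I : ℂ)⁻¹ * ∫ x in Omega α β ∩ Icc (-ρ i) (ρ i),
          conj (genEigen α β w θ φ ψ ξ x) * deriv F x := by
      rw [← integral_const_mul]
      refine integral_congr_ae ?_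
      filter_upwards [ae_mono (sub (ρ i)) hP] with x hx
      rw [hx]
      ring
    have k2 : ∫ x in Omega α β ∩ Icc (-ρ i) (ρ i), conj (genEigen α β w θ φ ψ ξ x) *
        (f : L2Omega α β) x =
        ∫ x in Omega α β ∩ Icc (-ρ i) (ρ i), conj (genEigen α β w θ φ ψ ξ x) * F x := by
      refine integral_congr_ae ?_
      filter_upwards [ae_mono (sub (ρ i)) hF.ae_eq] with x hx
      rw [hx]
    rw [k1, k2, setIntegral_genEigen_mul_deriv hα hβ hw0 hw1 hF (show β < ρ i from hrβ _)]
    field_simp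
  have t0 : ∀ (c : ℂ) (s : ℕ → ℝ) (G : ℕ → ℂ), Tendsto G atTop (𝓝 0) →
      Tendsto (fun i => c * (e (s i) * G i)) atTop (𝓝 0) := fun c s G hG => by
    have h3 : Tendsto (fun i => e (s i) * G i) atTop (𝓝 0) :=
      squeeze_zero_norm (fun i => by rw [norm_mul, norm_e, one_mul])
        (tendsto_zero_iff_norm_tendsto_zero.1 hG)
    simpa using h3.const_mul c
  have t1 := (((t0 (conj (coeffC α β w θ φ ψ ξ)) (fun i => -(ξ * ρ i)) _ (hz1.comp hρ)).sub
    (t0 (conj (coeffA α w φ ψ ξ)) (fun i => ξ * ρ i) _ (hz2.comp hρ))).const_mul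
    (2 * Real.pi * Complex.I : ℂ)⁻¹).add ((h1.comp hm.tendsto_atTop).const_mul (ξ : ℂ))
  rw [sub_zero, mul_zero, zero_add] at t1
  exact t1.congr fun i => (key i).symm

end Momentum

end TwoIntervals

theorem theorem3p25 (α β : ℝ) (hα : 1 < α) (hβ : α < β) (w θ φ ψ : ℝ) (hw0 : 0 < w) (hw1 : w < 1)
    (B : Matrix.unitaryGroup (Fin 2) ℂ)
    (hB : (B : Matrix (Fin 2) (Fin 2) ℂ) = TwoIntervals.paramMatrix w θ φ ψ) :
    ∃ V : TwoIntervals.L2Omega α β ≃ₗᵢ[ℂ] Lp ℂ 2 (TwoIntervals.sigmaB α w φ ψ),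
      -- `V` is the transform `(V f)(ξ) = ⟨ψ_ξ, f⟩`: for all `f ∈ L²(Ω)` in the mean, and
      -- by an absolutely convergent integral when `f` is moreover integrable
      (∀ f : TwoIntervals.L2Omega α β, TwoIntervals.IsTransform α β w θ φ ψ f (V f)) ∧
      (∀ f : TwoIntervals.L2Omega α β, IntegrableOn f (TwoIntervals.Omega α β) →
        V f =ᵐ[TwoIntervals.sigmaB α w φ ψ] fun ξ =>
          ∫ x in TwoIntervals.Omega α β, conj (TwoIntervals.genEigen α β w θ φ ψ ξ x) * f x) ∧
      -- eigenfunction expansion and Parseval's identity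
      (∀ f : TwoIntervals.L2Omega α β, TwoIntervals.IsExpansion α β w θ φ ψ (V f) f) ∧
      (∀ f : TwoIntervals.L2Omega α β,
        ∫ x in TwoIntervals.Omega α β, ‖f x‖ ^ 2 =
          ∫ ξ, ‖V f ξ‖ ^ 2 ∂(TwoIntervals.sigmaB α w φ ψ)) ∧
      -- diagonalization of `P_B`
      (∀ f : (TwoIntervals.momentum α β (B : Matrix (Fin 2) (Fin 2) ℂ)).domain,
        (V (TwoIntervals.momentum α β (B : Matrix (Fin 2) (Fin 2) ℂ) f)
          =ᵐ[TwoIntervals.sigmaB α w φ ψ] fun ξ => (ξ : ℂ) * V f ξ) ∧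
        TwoIntervals.IsExpansion α β w θ φ ψ
          (V (TwoIntervals.momentum α β (B : Matrix (Fin 2) (Fin 2) ℂ) f))
          (TwoIntervals.momentum α β (B : Matrix (Fin 2) (Fin 2) ℂ) f) ∧
        TwoIntervals.IsExpansion α β w θ φ ψ (fun ξ => (ξ : ℂ) * V f ξ)
          (TwoIntervals.momentum α β (B : Matrix (Fin 2) (Fin 2) ℂ) f)) := by
  rw [hB]
  obtain ⟨V, hV⟩ := TwoIntervals.exists_isometryEquiv_integral (θ := θ) (φ := φ) (ψ := ψ)
    hα hβ hw0 hw1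
  refine ⟨V, TwoIntervals.isTransform hV, hV, TwoIntervals.isExpansion hV hw0,
    TwoIntervals.parseval V, fun f => ?_⟩
  have hP := TwoIntervals.transform_momentum hα hβ hw0 hw1 hV f
  have hE := TwoIntervals.isExpansion hV hw0
    (TwoIntervals.momentum α β (TwoIntervals.paramMatrix w θ φ ψ) f)
  refine ⟨hP, hE, hE.congr fun R => eLpNorm_congr_ae (Eventually.of_forall fun x => ?_)⟩
  simp only
  congr 1
  refine integral_congr_ae ?_
  filter_upwards [ae_restrict_of_ae hP] with ξ hξ
  rw [hξ]
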